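/- Let $d\ge 1$ and $k\ge 1$ be integers. For a finite or locally finite set $S\subset\mathbb{R}^d$ let $G_k(S)$ be the undirected $k$-nearest-neighbour graph on $S$ with respect to the Euclidean distance: two distinct points $x,y\in S$ are adjacent if $y$ is one of the $k$ nearest neighbours of $x$ in $S$ or $x$ is one of the $k$ nearest neighbours of $y$ in $S$, where $y$ is one of the $k$ nearest neighbours of $x$ if fewer than $k$ points of $S\setminus\{x\}$ are strictly closer to $x$ than $y$ is. Let $\mathcal{H}_1$ be a homogeneous Poisson process of rate $1$ on $\mathbb{R}^d$, and let \[ p_\ell^* = \mathbb{P}\bigl(\text{the degree of } \mathbf{0} \text{ in } G_k(\mathcal{H}_1\cup\{\mathbf{0}\}) \text{ equals } \ell\bigr), \] a number that depends only on $d$, $k$ and $\ell$. There exists an integer $K>k$, depending only on $d$ and $k$, such that $\sum_{\ell=k}^K p_\ell^*=1$ and the following holds for every probability density $f$ on $\mathbb{R}^d$ (with respect to Lebesgue measure). (1) Poisson process. For $\nu>0$ let $\mathcal{P}_\nu=\{X_1,\dots,X_N\}$, where $N$ is a Poisson random variable with mean $\nu$ and $X_1,X_2,\dots$ are i.i.d.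 with density $f$, independent of $N$; let $V_{\ell,\nu}$ be the number of vertices of degree $\ell$ in $G_k(\mathcal{P}_\nu)$. Almost surely, all degrees in $G_k(\mathcal{P}_\nu)$ are at most $K$, and they are all at least $k$ if $|\mathcal{P}_\nu|>k$. For all $k\le\ell\le K$ the variable $V_{\ell,\nu}$ is integrable and \[ \lim_{\nu\to\infty}\frac1\nu\,\mathbb{E}[V_{\ell,\nu}] = p_\ell^*. \] (2) Binomial process. On a common probability space, for every $n$ let $\mathcal{X}_n$ be a set of $n$ i.i.d. points with density $f$ (the joint law of $\mathcal{X}_n$ for different $n$ is arbitrary; for instance $\mathcal{X}_n$ may consist of the first $n$ points of one i.i.d. sequence), and let $V_{\ell,n}$ be the number of vertices of degree $\ell$ in $G_k(\mathcal{X}_n)$. For every $n$, almost surely, all degrees in $G_k(\mathcal{X}_n)$ are at most $K$, and they are all at least $k$ if $n>k$. For all $k\le\ell\le K$ the variable $V_{\ell,n}$ is integrable and \[ \lim_{n\to\infty}\frac1n\,\mathbb{E}[V_{\ell,n}] = p_\ell^*, \] and, almost surely, for all $k\le\ell\le K$, \[ \lim_{n\to\infty}\frac1n\,V_{\ell,n}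 = p_\ell^*. \] -/

import Mathlib

open MeasureTheory ProbabilityTheory Filter
open scoped Topology NNReal ENNReal

noncomputable section

namespace KNN

/-! ### The `k`-nearest-neighbour graph -/

/-- `y` is one of the `k` nearest neighbours of `x` in the point set `S`: it is a point of `S`
other than `x`, and fewer than `k` points of `S` other than `x` are strictly closer to `x`. -/
def IsNearestNeighbor {E : Type*} [Dist E] (k : ℕ) (S : Set E) (x y : E) : Prop :=
  y ∈ S ∧ y ≠ x ∧ {z | z ∈ S ∧ z ≠ x ∧ dist z x < dist y x}.encard < (k : ℕ∞)

/-- The undirected `k`-nearest-neighbour graph on the point set `S`: two distinct points of `S` are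
adjacent if one of them is among the `k` nearest neighbours of the other. (Points of the ambient
space outside `S` are isolated and are never counted as vertices.) -/
def graph {E : Type*} [Dist E] (k : ℕ) (S : Set E) : SimpleGraph E where
  Adj x y := x ∈ S ∧ y ∈ S ∧ x ≠ y ∧ (IsNearestNeighbor k S x y ∨ IsNearestNeighbor k S y x)
  symm := ⟨fun _ _ h => ⟨h.2.1, h.1, h.2.2.1.symm, h.2.2.2.symm⟩⟩
  loopless := ⟨fun _ h => h.2.2.1 rfl⟩

/-- The degree of `x` in the `k`-nearest-neighbour graph on `S` (possibly infinite). -/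
def degree {E : Type*} [Dist E] (k : ℕ) (S : Set E) (x : E) : ℕ∞ :=
  ((graph k S).neighborSet x).encard

/-- The number of vertices of degree `ℓ` in the `k`-nearest-neighbour graph on a finite set `S`. -/
def vertexCount {E : Type*} [Dist E] (k ℓ : ℕ) (S : Set E) : ℕ :=
  {x | x ∈ S ∧ degree k S x = (ℓ : ℕ∞)}.ncard

/-! ### Densities and point processes -/

/-- `f` is a probability density function with respect to Lebesgue measure. -/
structure IsProbDensity {d : ℕ} (f : EuclideanSpace ℝ (Fin d) → ℝ) : Prop where
  nonneg : ∀ x, 0 ≤ f x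
  integrable : Integrable f
  integral_eq_one : ∫ x, f x = 1

/-- The measure `f(x) dx`. -/
def densityMeasure {d : ℕ} (f : EuclideanSpace ℝ (Fin d) → ℝ) :
    Measure (EuclideanSpace ℝ (Fin d)) :=
  volume.withDensity fun x => ENNReal.ofReal (f x)

theorem IsProbDensity.isProbabilityMeasure {d : ℕ} {f : EuclideanSpace ℝ (Fin d) → ℝ}
    (hf : IsProbDensity f) : IsProbabilityMeasure (densityMeasure f) := by
  constructor
  rw [densityMeasure, withDensity_apply _ MeasurableSet.univ, Measure.restrict_univ,
    ← ofReal_integral_eq_lintegral_ofReal hf.integrable (Eventually.of_forall hf.nonneg),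
    hf.integral_eq_one, ENNReal.ofReal_one]

/-- The law of a pair `(N, (X₀, X₁, …))`, where `N` is Poisson with mean `ν`, the `Xᵢ` are
independent with law `μ` (a probability measure), and `N` is independent of `(X₀, X₁, …)`. -/
def poissonLaw {E : Type*} [MeasurableSpace E] (ν : ℝ≥0) (μ : Measure E) :
    Measure (ℕ × (ℕ → E)) :=
  (poissonMeasure ν).prod (Measure.infinitePi fun _ : ℕ => μ)

instance {E : Type*} [MeasurableSpace E] (ν : ℝ≥0) (μ : Measure E) [IsProbabilityMeasure μ] :
    IsProbabilityMeasure (poissonLaw ν μ) := by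
  unfold poissonLaw
  infer_instance

/-- The point set `{X₀, …, X_{N-1}}` described by a pair `(N, (X₀, X₁, …))`. If the pair has law
`poissonLaw ν μ`, this is a Poisson process with intensity measure `ν • μ`. -/
def pointSet {E : Type*} (ω : ℕ × (ℕ → E)) : Set E :=
  ω.2 '' {i | i < ω.1}

/-! ### The homogeneous Poisson process of rate one on the whole space -/

/-- The half-open unit cube with lowest corner `z`. -/
def unitCube {d : ℕ} (z : Fin d → ℤ) : Set (EuclideanSpace ℝ (Fin d)) :=
  {x | ∀ i, (z i : ℝ) ≤ x i ∧ x i < z i + 1}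

/-- The uniform distribution on a unit cube. -/
def cubeMeasure {d : ℕ} (z : Fin d → ℤ) : Measure (EuclideanSpace ℝ (Fin d)) :=
  volume.restrict (unitCube z)

instance {d : ℕ} (z : Fin d → ℤ) : IsProbabilityMeasure (cubeMeasure z) := by
  constructor
  have h : unitCube z = (MeasurableEquiv.toLp 2 (Fin d → ℝ)).symm ⁻¹'
      Set.univ.pi fun i => Set.Ico (z i : ℝ) (z i + 1) := by
    ext x
    simp [unitCube]
  rw [cubeMeasure, Measure.restrict_apply MeasurableSet.univ, Set.univ_inter, h,
    (EuclideanSpace.volume_preserving_symm_measurableEquiv_toLp (Fin d)).measure_preimage_equiv,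
    Real.volume_pi_Ico]
  simp

/-- The law of the points in all unit cubes with integer corners: independently over the cubes,
a Poisson number of mean one of independent uniform points. -/
def homogeneousLaw (d : ℕ) :
    Measure ((Fin d → ℤ) → ℕ × (ℕ → EuclideanSpace ℝ (Fin d))) :=
  Measure.infinitePi fun z => poissonLaw 1 (cubeMeasure z)

/-- The homogeneous Poisson process of rate one on `ℝᵈ`, as a random set on the probability space
`homogeneousLaw d`: the union of the independent Poisson processes in the unit cubes. -/
def homogeneousSet {d : ℕ} (ω : (Fin d → ℤ) → ℕ × (ℕ → EuclideanSpace ℝ (Fin d))) :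
    Set (EuclideanSpace ℝ (Fin d)) :=
  ⋃ z, pointSet (ω z)

/-- The probability that the origin has degree `ℓ` in the `k`-nearest-neighbour graph on the
homogeneous Poisson process of rate one on `ℝᵈ` with the origin added. -/
def limitProb (d k ℓ : ℕ) : ℝ :=
  (homogeneousLaw d).real
    {ω | degree k (insert (0 : EuclideanSpace ℝ (Fin d)) (homogeneousSet ω)) 0 = (ℓ : ℕ∞)}

end KNN

end

/-! The proof counts vertices through a typical point. By exchangeability the mean number of
vertices of degree `ℓ` among `n + 1` i.i.d. points is `(n + 1) * degreeProb k ℓ f n`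
(`integral_vertexCount_range`), and for Poisson input the identity `(m + 1) P(N = m + 1) = ν P(N =
m)` gives `ν` times the Poisson average of `degreeProb` (`integral_vertexCount_pointSet`). Both mean
statements therefore reduce to `tendsto_degreeProb`.

Geometry enters through finitely many cones covering the space, in each of which two vectors make an
angle below sixty degrees. In such a cone the shorter vector is nearer to the longer one than the
apex is. Hence at most `k` points per cone can have the apex among their `k` nearest neighbours,
which bounds all degrees when there are no ties (`TieFree.degree_le`). For the same reason, if each
cone at the origin has `k` points within distance `r`, the degree of the origin depends only on the
configuration in the ball of radius `2 * r` (`Filled.degree_inter`). The homogeneous process almost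
surely fills the cones at some finite radius (`ae_exists_filled`).

Around a Lebesgue point `x` with `f x > 0`, magnification by `(n * f x) ^ (1 / d)` makes the sample
look like the homogeneous process in every bounded window. Only an inequality is proved for this:
the Poisson mean of a bounded local functional is at most the liminf of the binomial means
(`poisson_le_liminf_binomial`). Both means are expanded in powers of the operator `addPoint`, which
integrates over the position of one more point, and Fatou's lemma is applied to each iterated
integral and to the series. Used for a set of degrees and for its complement, the inequality yields
convergence (`tendsto_measure_degree`); dominated convergence then integrates over `x`.

For the almost sure statement, moving one point changes the count by a bounded amount, because few
vertices see the change (`abs_vertexCount_sub_le`). McDiarmid's inequality gives summable deviation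
probabilities, and the first Borel–Cantelli lemma, which needs no joint law, concludes
(`ae_tendsto_vertexCount_range`). -/

noncomputable section

namespace KNN

/-! ### Degrees -/

section Dist

variable {E : Type*} [MetricSpace E] {k : ℕ} {S R : Set E} {x y z : E}

theorem neighborSet_eq (hx : x ∈ S) :
    (graph k S).neighborSet x =
      {y | IsNearestNeighbor k S x y} ∪ {y | y ∈ S ∧ IsNearestNeighbor k S y x} := by
  ext y
  simp only [SimpleGraph.mem_neighborSet, graph, Set.mem_union, Set.mem_ofPred_eq]
  constructor
  · rintro ⟨_, hy, hxy, h | h⟩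
    · exact Or.inl h
    · exact Or.inr ⟨hy, h⟩
  · rintro (h | ⟨hy, h⟩)
    · exact ⟨hx, h.1, h.2.1.symm, Or.inl h⟩
    · exact ⟨hx, hy, h.2.1, Or.inr h⟩

/-- All distances from a point of `S` to the other points of `S` are different. -/
def TieFree (S : Set E) : Prop :=
  ∀ x ∈ S, ∀ y ∈ S, ∀ z ∈ S, y ≠ x → z ≠ x → dist y x = dist z x → y = z

theorem TieFree.mono (hS : TieFree S) (h : R ⊆ S) : TieFree R :=
  fun x hx y hy z hz => hS x (h hx) y (h hy) z (h hz)

/-- Among `k + 1` nearest neighbours the farthest would have `k` others strictly closer to `x`;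
strictness is where the absence of ties is used. -/
theorem TieFree.encard_nearest_le (hS : TieFree S) (hx : x ∈ S) :
    {y | IsNearestNeighbor k S x y}.encard ≤ k := by
  by_contra! hlt
  obtain ⟨t, hts, htc⟩ := Set.exists_subset_encard_eq (k := ((k + 1 : ℕ) : ℕ∞))
    (by push_cast; exact Order.add_one_le_of_lt hlt)
  have hfin : t.Finite := Set.finite_of_encard_eq_coe htc
  have hne : t.Nonempty := by
    rw [← Set.encard_pos, htc]; exact_mod_cast Nat.succ_pos k
  obtain ⟨y, hy, hmax⟩ := hfin.exists_maximalFor (fun y => dist y x) t hne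
  have hsub : t \ {y} ⊆ {z | z ∈ S ∧ z ≠ x ∧ dist z x < dist y x} := by
    rintro z ⟨hz, hzy⟩
    refine ⟨(hts hz).1, (hts hz).2.1, lt_of_le_of_ne ?_ ?_⟩
    · by_contra! hlt'
      exact absurd (hmax hz hlt'.le) (not_le.2 hlt')
    · intro h
      exact hzy (hS x hx z (hts hz).1 y (hts hy).1 (hts hz).2.1 (hts hy).2.1 h)
  have h1 := (Set.encard_le_encard hsub).trans_lt (hts hy).2.2
  have h3 : (t \ {y}).encard = k := by
    rw [Set.encard_sdiff_singleton_of_mem hy, htc]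
    exact_mod_cast Nat.add_sub_cancel k 1
  exact absurd h1 (by rw [h3]; exact lt_irrefl _)

/-- Ties do no harm here. If there were fewer than `k` nearest neighbours, a closest point among the
remaining ones would have only nearest neighbours strictly closer to `x`, so fewer than `k`, and
would itself qualify. -/
theorem le_encard_nearest (hfin : S.Finite) (hx : x ∈ S) (hk : (k : ℕ∞) < S.encard) :
    (k : ℕ∞) ≤ {y | IsNearestNeighbor k S x y}.encard := by
  by_contra! hlt
  have hsub : {y | IsNearestNeighbor k S x y} ⊆ S \ {x} := fun y hy => ⟨hy.1, hy.2.1⟩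
  have hcard : {y | IsNearestNeighbor k S x y}.encard < (S \ {x}).encard := by
    refine hlt.trans_le ?_
    have h2 := Set.encard_sdiff_singleton_add_one hx
    rw [← h2] at hk
    exact Order.le_of_lt_add_one hk
  have hne : ((S \ {x}) \ {y | IsNearestNeighbor k S x y}).Nonempty := by
    by_contra h
    rw [Set.not_nonempty_iff_eq_empty, Set.sdiff_eq_empty] at h
    exact absurd hcard (not_lt.2 (Set.encard_le_encard h))
  obtain ⟨y, hy, hmin⟩ := ((hfin.sdiff).sdiff).exists_minimalFor (fun y => dist y x) _ hne
  refine hy.2 ⟨hy.1.1, hy.1.2, lt_of_le_of_lt (Set.encard_le_encard ?_) hlt⟩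
  rintro z ⟨hz, hzx, hlt'⟩
  by_contra hzn
  exact absurd (hmin ⟨⟨hz, hzx⟩, hzn⟩ hlt'.le) (not_le.2 hlt')

theorem le_degree (hfin : S.Finite) (hx : x ∈ S) (hk : (k : ℕ∞) < S.encard) :
    (k : ℕ∞) ≤ degree k S x := by
  rw [degree, neighborSet_eq hx]
  exact (le_encard_nearest hfin hx hk).trans (Set.encard_le_encard Set.subset_union_left)

/-! ### Effect of adding one point. -/

theorem IsNearestNeighbor.anti (h : IsNearestNeighbor k S x y) (hRS : R ⊆ S) (hy : y ∈ R) :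
    IsNearestNeighbor k R x y :=
  ⟨hy, h.2.1, (Set.encard_le_encard (t := {z | z ∈ S ∧ z ≠ x ∧ dist z x < dist y x})
    fun _ hz => ⟨hRS hz.1, hz.2⟩).trans_lt h.2.2⟩

theorem IsNearestNeighbor.of_insert_not (h : IsNearestNeighbor k R x y)
    (hn : ¬ IsNearestNeighbor k (insert z R) x y) (hzx : z ≠ x) :
    IsNearestNeighbor k (insert z R) x z := by
  have hlt : dist z x < dist y x := by
    by_contra! hle
    refine hn ⟨Set.mem_insert_of_mem _ h.1, h.2.1,
      (Set.encard_le_encard fun w hw => ?_).trans_lt h.2.2⟩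
    obtain ⟨rfl | hw1, hw2, hw3⟩ := hw
    · exact absurd hw3 (not_lt.2 hle)
    · exact ⟨hw1, hw2, hw3⟩
  refine ⟨Set.mem_insert _ _, hzx, (Set.encard_le_encard fun w hw => ?_).trans_lt h.2.2⟩
  obtain ⟨rfl | hw1, hw2, hw3⟩ := hw
  · exact absurd hw3 (lt_irrefl _)
  · exact ⟨hw1, hw2, hw3.trans hlt⟩

/-- The new point `z` affects `x` in three ways only: it is adjacent to `x`; it displaces a nearest
neighbour of `x`, and is then itself one; or it displaces `x` from the nearest neighbours of some
`y`, which is then adjacent to `z` now and was adjacent to `x` before. The hypotheses `h1` and `h2`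
exclude these. -/
theorem neighborSet_insert_eq (hx : x ∈ R) (hz : z ∉ R)
    (h1 : x ∉ (graph k (insert z R)).neighborSet z)
    (h2 : ∀ y ∈ (graph k (insert z R)).neighborSet z, x ∉ (graph k R).neighborSet y) :
    (graph k (insert z R)).neighborSet x = (graph k R).neighborSet x := by
  have hzS : z ∈ insert z R := Set.mem_insert _ _
  have hzx : ∀ y ∈ R, z ≠ y := fun y hy h => hz (h ▸ hy)
  rw [neighborSet_eq hzS] at h1 h2
  rw [neighborSet_eq hx, neighborSet_eq (Set.mem_insert_of_mem z hx)]
  ext w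
  constructor
  · rintro (hw | ⟨hwS, hw⟩)
    · have hwz : w ≠ z := by
        rintro rfl
        exact h1 (Or.inr ⟨Set.mem_insert_of_mem _ hx, hw⟩)
      exact Or.inl (hw.anti (Set.subset_insert _ _) (hw.1.resolve_left hwz))
    · have hwz : w ≠ z := by
        rintro rfl
        exact h1 (Or.inl hw)
      exact Or.inr ⟨hwS.resolve_left hwz, hw.anti (Set.subset_insert _ _) hx⟩
  · rintro (hw | ⟨hwS, hw⟩)
    · left
      by_contra hn
      exact h1 (Or.inr ⟨Set.mem_insert_of_mem _ hx, hw.of_insert_not hn (hzx x hx)⟩)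
    · right
      refine ⟨Set.mem_insert_of_mem _ hwS, ?_⟩
      by_contra hn
      refine h2 w (Or.inr ⟨Set.mem_insert_of_mem _ hwS, hw.of_insert_not hn (hzx w hwS)⟩) ?_
      rw [neighborSet_eq hwS]
      exact Or.inl hw

theorem neighborSet_subset : (graph k S).neighborSet x ⊆ S := fun _ h => h.2.1

theorem vertexCount_insert_le {ℓ K : ℕ} (hfin : R.Finite) (hz : z ∉ R)
    (hK : ∀ x ∈ insert z R, degree k (insert z R) x ≤ K) (hK' : ∀ x ∈ R, degree k R x ≤ K) :
    vertexCount k ℓ (insert z R) ≤ vertexCount k ℓ R + (1 + K + K * K) ∧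
      vertexCount k ℓ R ≤ vertexCount k ℓ (insert z R) + (1 + K + K * K) := by
  classical
  set N := (graph k (insert z R)).neighborSet z with hN
  have hSfin : (insert z R).Finite := hfin.insert z
  have hNfin : N.Finite := hSfin.subset neighborSet_subset
  have hNc : N.ncard ≤ K := by
    have := hK z (Set.mem_insert _ _)
    rw [degree, ← hN, ← hNfin.cast_ncard_eq] at this
    exact_mod_cast this
  -- Every vertex whose degree can change: `z`, its at most `K` new neighbours, and their old
  -- neighbours, at most `K` for each.
  set B : Set E := {z} ∪ (N ∪ ⋃ y ∈ hNfin.toFinset, (graph k R).neighborSet y) with hB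
  have hBc : B.ncard ≤ 1 + K + K * K := by
    have h3 : (⋃ y ∈ hNfin.toFinset, (graph k R).neighborSet y).ncard ≤ K * K := by
      refine (Finset.set_ncard_biUnion_le _ _).trans ?_
      calc _ ≤ ∑ y ∈ hNfin.toFinset, K := by
            refine Finset.sum_le_sum fun y hy => ?_
            by_cases hyR : y ∈ R
            · have := hK' y hyR
              rw [degree, ← (hfin.subset neighborSet_subset).cast_ncard_eq] at this
              exact_mod_cast this
            · have : (graph k R).neighborSet y = ∅ := by
                ext w
                simp [graph, hyR]
              simp [this]
        _ = N.ncard * K := by rw [Finset.sum_const, smul_eq_mul, Set.ncard_eq_toFinset_card N hNfin]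
        _ ≤ K * K := Nat.mul_le_mul_right _ hNc
    have h1 := Set.ncard_union_le {z} (N ∪ ⋃ y ∈ hNfin.toFinset, (graph k R).neighborSet y)
    have h2 := Set.ncard_union_le N (⋃ y ∈ hNfin.toFinset, (graph k R).neighborSet y)
    rw [Set.ncard_singleton] at h1
    rw [hB]
    omega
  have hBfin : B.Finite := by
    refine hSfin.subset ?_
    refine Set.union_subset (by simp) (Set.union_subset neighborSet_subset ?_)
    exact Set.iUnion₂_subset fun y _ => neighborSet_subset.trans (Set.subset_insert _ _)
  have key : ∀ x ∈ R, x ∉ B → degree k (insert z R) x = degree k R x := by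
    intro x hx hxB
    rw [degree, degree, neighborSet_insert_eq hx hz]
    · exact fun h => hxB (Or.inr (Or.inl h))
    · intro y hy h
      exact hxB (Or.inr (Or.inr (Set.mem_biUnion (x := y) (hNfin.mem_toFinset.2 hy) h)))
  constructor
  · refine (Set.ncard_le_ncard (t := {x | x ∈ R ∧ degree k R x = (ℓ : ℕ∞)} ∪ B) ?_ ?_).trans
      ((Set.ncard_union_le _ _).trans (Nat.add_le_add_left hBc _))
    · rintro x ⟨hx, hd⟩
      by_cases hxB : x ∈ B
      · exact Or.inr hxB
      · have hxR : x ∈ R := hx.resolve_left fun h => hxB (Or.inl h)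
        exact Or.inl ⟨hxR, by rw [← key x hxR hxB, hd]⟩
    · exact (hfin.subset fun x hx => hx.1).union hBfin
  · refine (Set.ncard_le_ncard
      (t := {x | x ∈ insert z R ∧ degree k (insert z R) x = (ℓ : ℕ∞)} ∪ B) ?_ ?_).trans
      ((Set.ncard_union_le _ _).trans (Nat.add_le_add_left hBc _))
    · rintro x ⟨hx, hd⟩
      by_cases hxB : x ∈ B
      · exact Or.inr hxB
      · exact Or.inl ⟨Set.mem_insert_of_mem _ hx, by rw [key x hx hxB, hd]⟩
    · exact (hSfin.subset fun x hx => hx.1).union hBfin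

/-! ### Invariance under similarities. -/

theorem isNearestNeighbor_image {s : ℝ} (hs : 0 < s) (φ : E ≃ E)
    (hφ : ∀ a b, dist (φ a) (φ b) = s * dist a b) :
    IsNearestNeighbor k (φ '' S) (φ x) (φ y) ↔ IsNearestNeighbor k S x y := by
  have : {z | z ∈ φ '' S ∧ z ≠ φ x ∧ dist z (φ x) < dist (φ y) (φ x)} =
      φ '' {z | z ∈ S ∧ z ≠ x ∧ dist z x < dist y x} := by
    ext w
    obtain ⟨w, rfl⟩ := φ.surjective w
    simp [hφ, hs]
    tauto
  rw [IsNearestNeighbor, IsNearestNeighbor, this, φ.injective.encard_image]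
  simp

theorem degree_image {s : ℝ} (hs : 0 < s) (φ : E ≃ E)
    (hφ : ∀ a b, dist (φ a) (φ b) = s * dist a b) :
    degree k (φ '' S) (φ x) = degree k S x := by
  have : (graph k (φ '' S)).neighborSet (φ x) = φ '' (graph k S).neighborSet x := by
    ext w
    obtain ⟨w, rfl⟩ := φ.surjective w
    simp [graph, isNearestNeighbor_image hs φ hφ]
  rw [degree, degree, this, φ.injective.encard_image]

end Dist

/-! ### Narrow cones -/

section Cone

variable {E : Type*} [NormedAddCommGroup E] [NormedSpace ℝ E]

/-- A cone with apex `0` around the direction `c` so narrow that two of its vectors make an angle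
of less than sixty degrees. -/
def cone (c : E) : Set E := {u | u ≠ 0 ∧ ‖‖u‖⁻¹ • u - c‖ < 1 / 2}

/-- The normalized vectors differ by less than `1`. Shrinking `v` to length `‖u‖` costs `‖v‖ - ‖u‖`,
and turning it into `u` costs less than `‖u‖`. -/
theorem norm_sub_lt_of_mem_cone {c u v : E} (hu : u ∈ cone c) (hv : v ∈ cone c)
    (h : ‖u‖ ≤ ‖v‖) : ‖u - v‖ < ‖v‖ := by
  have hu0 : 0 < ‖u‖ := norm_pos_iff.2 hu.1
  have hv0 : 0 < ‖v‖ := norm_pos_iff.2 hv.1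
  have h1 : ‖‖u‖⁻¹ • u - ‖v‖⁻¹ • v‖ < 1 := by
    have := norm_sub_le_norm_sub_add_norm_sub (‖u‖⁻¹ • u) c (‖v‖⁻¹ • v)
    rw [norm_sub_rev c] at this
    linarith [hu.2, hv.2]
  have h2 : u - v = ‖u‖ • (‖u‖⁻¹ • u - ‖v‖⁻¹ • v) + (‖u‖ * ‖v‖⁻¹ - 1) • v := by
    rw [smul_sub, smul_smul, smul_smul, mul_inv_cancel₀ hu0.ne', sub_smul]
    module
  have h3 : ‖(‖u‖ * ‖v‖⁻¹ - 1) • v‖ = ‖v‖ - ‖u‖ := by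
    rw [norm_smul, Real.norm_eq_abs, abs_of_nonpos]
    · field_simp
      ring
    · rw [sub_nonpos, ← div_eq_mul_inv, div_le_one hv0]
      exact h
  have h4 : ‖‖u‖ • (‖u‖⁻¹ • u - ‖v‖⁻¹ • v)‖ < ‖u‖ := by
    rw [norm_smul, norm_norm]
    nlinarith
  calc ‖u - v‖ ≤ _ + _ := by rw [h2]; exact norm_add_le _ _
    _ < ‖v‖ := by rw [h3]; linarith

theorem exists_cone_cover [FiniteDimensional ℝ E] :
    ∃ T : Finset E, (∀ c ∈ T, ‖c‖ = 1) ∧ ∀ u : E, u ≠ 0 → ∃ c ∈ T, u ∈ cone c := by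
  classical
  have := FiniteDimensional.proper_real E
  obtain ⟨t, hts, hfin, hcov⟩ := (isCompact_sphere (0 : E) 1).finite_cover_balls
    (e := 1 / 2) (by norm_num)
  refine ⟨hfin.toFinset, fun c hc => by simpa using hts (by simpa using hc), fun u hu => ?_⟩
  have : ‖u‖⁻¹ • u ∈ Metric.sphere (0 : E) 1 := by
    rw [mem_sphere_zero_iff_norm, norm_smul, norm_inv, norm_norm,
      inv_mul_cancel₀ (norm_ne_zero_iff.2 hu)]
  obtain ⟨c, hc, hcu⟩ := Set.mem_iUnion₂.1 (hcov this)
  exact ⟨c, by simpa using hc, hu, by simpa [dist_eq_norm] using hcu⟩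

variable {T : Finset E} {k : ℕ} {S : Set E} {x : E}

/-- Each cone with apex `x` holds at most `k` such points: among `k + 1` of them, the farthest from
`x` would have the `k` others strictly closer than `x`. The strictness comes from the angle, so ties
are allowed. -/
theorem encard_inNeighbors_le (hT : ∀ u : E, u ≠ 0 → ∃ c ∈ T, u ∈ cone c) :
    {y | y ∈ S ∧ IsNearestNeighbor k S y x}.encard ≤ (k * T.card : ℕ) := by
  have hsub : {y | y ∈ S ∧ IsNearestNeighbor k S y x} ⊆
      ⋃ c ∈ T, {y | (y ∈ S ∧ IsNearestNeighbor k S y x) ∧ y - x ∈ cone c} := by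
    intro y hy
    obtain ⟨c, hc, hyc⟩ := hT (y - x) (sub_ne_zero.2 hy.2.2.1.symm)
    exact Set.mem_biUnion hc ⟨hy, hyc⟩
  refine (Set.encard_le_encard hsub).trans ((T.set_encard_biUnion_le _).trans ?_)
  rw [mul_comm]
  push_cast
  rw [← nsmul_eq_mul]
  refine Finset.sum_le_card_nsmul _ _ _ fun c _ => ?_
  by_contra! hlt
  obtain ⟨t, hts, htc⟩ := Set.exists_subset_encard_eq (k := ((k + 1 : ℕ) : ℕ∞))
    (by push_cast; exact Order.add_one_le_of_lt hlt)
  have hfin : t.Finite := Set.finite_of_encard_eq_coe htc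
  have hne : t.Nonempty := by
    rw [← Set.encard_pos, htc]; exact_mod_cast Nat.succ_pos k
  obtain ⟨y, hy, hmax⟩ := hfin.exists_maximalFor (fun y => ‖y - x‖) t hne
  have hsub : t \ {y} ⊆ {z | z ∈ S ∧ z ≠ y ∧ dist z y < dist x y} := by
    rintro z ⟨hz, hzy⟩
    refine ⟨(hts hz).1.1, hzy, ?_⟩
    have hle : ‖z - x‖ ≤ ‖y - x‖ := by
      by_contra! hlt'
      exact absurd (hmax hz hlt'.le) (not_le.2 hlt')
    have := norm_sub_lt_of_mem_cone (hts hz).2 (hts hy).2 hle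
    rwa [sub_sub_sub_cancel_right, ← dist_eq_norm, ← dist_eq_norm, dist_comm y x] at this
  have h1 := (Set.encard_le_encard hsub).trans_lt (hts hy).1.2.2.2
  have h3 : (t \ {y}).encard = k := by
    rw [Set.encard_sdiff_singleton_of_mem hy, htc]
    exact_mod_cast Nat.add_sub_cancel k 1
  exact absurd h1 (by rw [h3]; exact lt_irrefl _)

theorem TieFree.degree_le (hS : TieFree S) (hT : ∀ u : E, u ≠ 0 → ∃ c ∈ T, u ∈ cone c)
    (hx : x ∈ S) : degree k S x ≤ (k + k * T.card : ℕ) := by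
  rw [degree, neighborSet_eq hx]
  refine (Set.encard_union_le _ _).trans ?_
  push_cast
  exact add_le_add (hS.encard_nearest_le hx) (by exact_mod_cast encard_inNeighbors_le hT)

/-! ### Stabilization -/

/-- Every cone of the family `T` has at least `k` points of `S` at distance at most `r` from the
origin. -/
def Filled (k : ℕ) (T : Finset E) (r : ℝ) (S : Set E) : Prop :=
  ∀ c ∈ T, (k : ℕ∞) ≤ (S ∩ (cone c ∩ Metric.closedBall 0 r)).encard

theorem Filled.mono {S' : Set E} {r r' : ℝ} (h : Filled k T r S) (hr : r ≤ r') (hS : S ⊆ S') :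
    Filled k T r' S' := fun c hc => (h c hc).trans <| Set.encard_le_encard <|
  Set.inter_subset_inter hS (Set.inter_subset_inter_right _ (Metric.closedBall_subset_closedBall hr))

theorem filled_inter_iff {W : Set E} {r : ℝ} (hW : Metric.closedBall 0 r ⊆ W) :
    Filled k T r (S ∩ W) ↔ Filled k T r S := by
  refine ⟨fun h => h.mono le_rfl Set.inter_subset_left, fun h c hc => (h c hc).trans ?_⟩
  exact Set.encard_le_encard fun z hz => ⟨⟨hz.1, hW hz.2.2⟩, hz.2⟩

/-- The `k` points in the cone containing `y` are closer to the origin than `y` is, and by the angle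
condition closer to `y` than the origin is. They defeat both relations. -/
theorem Filled.not_nearest {r : ℝ} (hT : ∀ u : E, u ≠ 0 → ∃ c ∈ T, u ∈ cone c)
    (h : Filled k T r S) {y : E} (hy : r < ‖y‖) (hy0 : y ≠ 0) :
    ¬ IsNearestNeighbor k S 0 y ∧ ¬ IsNearestNeighbor k S y 0 := by
  obtain ⟨c, hc, hyc⟩ := hT y hy0
  have hz : ∀ z ∈ S ∩ (cone c ∩ Metric.closedBall 0 r), ‖z‖ < ‖y‖ := fun z hz =>
    (mem_closedBall_zero_iff.1 hz.2.2).trans_lt hy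
  constructor
  · intro hn
    refine absurd hn.2.2 (not_lt.2 ((h c hc).trans (Set.encard_le_encard fun z hz' => ?_)))
    exact ⟨hz'.1, hz'.2.1.1, by simpa using hz z hz'⟩
  · intro hn
    refine absurd hn.2.2 (not_lt.2 ((h c hc).trans (Set.encard_le_encard fun z hz' => ?_)))
    refine ⟨hz'.1, ?_, ?_⟩
    · rintro rfl
      exact lt_irrefl _ (hz z hz')
    · have := norm_sub_lt_of_mem_cone hz'.2.1 hyc (hz z hz').le
      rwa [dist_eq_norm, dist_zero_left]

/-- Neighbours of the origin have norm at most `r`. For such `y`, the points that decide the two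
relations lie within `‖y‖` of `0` or of `y`, hence in the ball of radius `2 * r`. -/
theorem Filled.degree_inter {r : ℝ} {W : Set E} (hT : ∀ u : E, u ≠ 0 → ∃ c ∈ T, u ∈ cone c)
    (h : Filled k T r S) (hr : 0 ≤ r) (hW : Metric.closedBall 0 (2 * r) ⊆ W) :
    degree k (insert 0 (S ∩ W)) 0 = degree k (insert 0 S) 0 := by
  have hmem : ∀ z : E, ‖z‖ ≤ 2 * r → (z ∈ insert 0 (S ∩ W) ↔ z ∈ insert 0 S) := fun z hz => by
    have := hW (mem_closedBall_zero_iff.2 hz)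
    simp [this]
  have h1 : Filled k T r (insert 0 S) := h.mono le_rfl (Set.subset_insert _ _)
  have h2 : Filled k T r (insert 0 (S ∩ W)) :=
    ((filled_inter_iff ((Metric.closedBall_subset_closedBall (by linarith)).trans hW)).2 h).mono
      le_rfl (Set.subset_insert _ _)
  rw [degree, degree, neighborSet_eq (Set.mem_insert _ _), neighborSet_eq (Set.mem_insert _ _)]
  congr 1
  ext y
  by_cases hy0 : y = 0
  · subst hy0
    simp [IsNearestNeighbor]
  by_cases hyr : r < ‖y‖
  · have := h1.not_nearest hT hyr hy0
    have := h2.not_nearest hT hyr hy0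
    simp_all
  push Not at hyr
  have e1 : IsNearestNeighbor k (insert 0 (S ∩ W)) 0 y ↔ IsNearestNeighbor k (insert 0 S) 0 y := by
    unfold IsNearestNeighbor
    rw [hmem y (by linarith)]
    suffices heq : {z | z ∈ insert 0 (S ∩ W) ∧ z ≠ 0 ∧ dist z 0 < dist y 0} =
        {z | z ∈ insert 0 S ∧ z ≠ 0 ∧ dist z 0 < dist y 0} by rw [heq]
    ext z
    simp only [Set.mem_ofPred_eq, dist_zero_right]
    refine and_congr_left fun hz => hmem z ?_
    linarith [hz.2]
  have e2 : IsNearestNeighbor k (insert 0 (S ∩ W)) y 0 ↔ IsNearestNeighbor k (insert 0 S) y 0 := by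
    unfold IsNearestNeighbor
    rw [hmem 0 (by simpa using hr)]
    suffices heq : {z | z ∈ insert 0 (S ∩ W) ∧ z ≠ y ∧ dist z y < dist 0 y} =
        {z | z ∈ insert 0 S ∧ z ≠ y ∧ dist z y < dist 0 y} by rw [heq]
    ext z
    simp only [Set.mem_ofPred_eq, dist_zero_left]
    refine and_congr_left fun hz => hmem z ?_
    have := norm_le_norm_add_norm_sub y z
    rw [dist_eq_norm, norm_sub_rev] at hz
    linarith [hz.2]
  simp only [Set.mem_union, Set.mem_ofPred_eq, e1, e2, hmem y (by linarith)]

end Cone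

/-! ### Measurability -/

theorem pointSet_finite {E : Type*} (ω : ℕ × (ℕ → E)) : (pointSet ω).Finite :=
  (Set.finite_lt_nat ω.1).image _

section Measurability

variable {Ω E : Type*} [MeasurableSpace Ω] [MeasurableSpace E]

/-- A random set is countably enumerated if it consists of countably many measurable random points,
each of which is present on a measurable event. -/
def Enumerated (S : Ω → Set E) : Prop :=
  ∃ (ι : Type) (_ : Countable ι) (X : ι → Ω → E) (p : ι → Ω → Prop), (∀ i, Measurable (X i)) ∧
    (∀ i, MeasurableSet {ω | p i ω}) ∧ ∀ ω, S ω = {y | ∃ i, p i ω ∧ X i ω = y}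

theorem Enumerated.insert {S : Ω → Set E} (hS : Enumerated S) {a : Ω → E} (ha : Measurable a) :
    Enumerated fun ω => insert (a ω) (S ω) := by
  obtain ⟨ι, _, X, p, hX, hp, h⟩ := hS
  refine ⟨Option ι, inferInstance, fun o => o.elim a X, fun o ω => o.elim True fun i => p i ω,
    ?_, ?_, ?_⟩
  · rintro (_ | i)
    exacts [ha, hX i]
  · rintro (_ | i)
    exacts [MeasurableSet.univ, hp i]
  · intro ω
    ext y
    simp [h, Option.exists, eq_comm]

theorem Enumerated.inter {S : Ω → Set E} (hS : Enumerated S) {W : Set E} (hW : MeasurableSet W) :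
    Enumerated fun ω => S ω ∩ W := by
  obtain ⟨ι, _, X, p, hX, hp, h⟩ := hS
  refine ⟨ι, inferInstance, X, fun i ω => p i ω ∧ X i ω ∈ W, hX,
    fun i => (hp i).inter (hX i hW), ?_⟩
  intro ω
  ext y
  simp only [h, Set.mem_inter_iff, Set.mem_ofPred_eq]
  constructor
  · rintro ⟨⟨i, hi, rfl⟩, hy⟩
    exact ⟨i, ⟨hi, hy⟩, rfl⟩
  · rintro ⟨i, ⟨hi, hy⟩, rfl⟩
    exact ⟨⟨i, hi, rfl⟩, hy⟩

theorem Enumerated.iUnion {κ : Type} [Countable κ] {S : κ → Ω → Set E}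
    (hS : ∀ z, Enumerated (S z)) : Enumerated fun ω => ⋃ z, S z ω := by
  choose ι hι X p hX hp h using hS
  refine ⟨Σ z, ι z, inferInstance, fun i => X i.1 i.2, fun i => p i.1 i.2,
    fun i => hX _ _, fun i => hp _ _, ?_⟩
  intro ω
  ext y
  simp [h, Sigma.exists]

theorem Enumerated.comp {Ω' : Type*} [MeasurableSpace Ω'] {S : Ω → Set E} (hS : Enumerated S)
    {g : Ω' → Ω} (hg : Measurable g) : Enumerated fun ω => S (g ω) := by
  obtain ⟨ι, _, X, p, hX, hp, h⟩ := hS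
  exact ⟨ι, inferInstance, fun i ω => X i (g ω), fun i ω => p i (g ω),
    fun i => (hX i).comp hg, fun i => hg (hp i), fun ω => h _⟩

theorem enumerated_range (m : ℕ) : Enumerated fun x : Fin m → E => Set.range x :=
  ⟨Fin m, inferInstance, fun i x => x i, fun _ _ => True, fun i => measurable_pi_apply i,
    fun _ => MeasurableSet.univ, fun x => by ext y; simp⟩

theorem enumerated_pointSet : Enumerated fun ω : ℕ × (ℕ → E) => pointSet ω := by
  refine ⟨ℕ, inferInstance, fun i ω => ω.2 i, fun i ω => i < ω.1, fun i => by fun_prop,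
    fun i => measurableSet_lt measurable_const measurable_fst, fun ω => ?_⟩
  ext y
  simp [pointSet]

/-- Measurability of `q` is required only along measurable random points. This lets nested
conditions such as adjacency be treated without a σ-algebra on the space of configurations. -/
theorem Enumerated.sep {S : Ω → Set E} (hS : Enumerated S) {q : Ω → E → Prop}
    (hq : ∀ a : Ω → E, Measurable a → MeasurableSet {ω | q ω (a ω)}) :
    Enumerated fun ω => {y | y ∈ S ω ∧ q ω y} := by
  obtain ⟨ι, _, X, p, hX, hp, h⟩ := hS
  refine ⟨ι, inferInstance, X, fun i ω => p i ω ∧ q ω (X i ω), hX,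
    fun i => (hp i).inter (hq _ (hX i)), ?_⟩
  intro ω
  ext y
  simp only [h, Set.mem_ofPred_eq]
  constructor
  · rintro ⟨⟨i, hi, rfl⟩, hy⟩
    exact ⟨i, ⟨hi, hy⟩, rfl⟩
  · rintro ⟨i, ⟨hi, hy⟩, rfl⟩
    exact ⟨⟨i, hi, rfl⟩, hy⟩

variable [MetricSpace E] [BorelSpace E] [SecondCountableTopology E] {S : Ω → Set E}

/-- An enumeration may list a point several times, so the event is a countable union over
`m`-element sets of indices that are present and carry pairwise different points. -/
theorem Enumerated.measurableSet_le_encard (hS : Enumerated S) (m : ℕ) :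
    MeasurableSet {ω | (m : ℕ∞) ≤ (S ω).encard} := by
  classical
  obtain ⟨ι, _, X, p, hX, hp, h⟩ := hS
  have heq : {ω | (m : ℕ∞) ≤ (S ω).encard} =
      ⋃ F : {F : Finset ι // F.card = m}, ((⋂ i ∈ F.1, {ω | p i ω}) ∩
        ⋂ i ∈ F.1, ⋂ j ∈ F.1, ⋂ _ : i ≠ j, {ω | X i ω = X j ω}ᶜ) := by
    ext ω
    simp only [Set.mem_ofPred_eq, Set.mem_iUnion, Set.mem_inter_iff, Set.mem_iInter,
      Set.mem_compl_iff]
    constructor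
    · intro hm
      obtain ⟨t, hts, htc⟩ := Set.exists_subset_encard_eq hm
      have hsurj : Set.SurjOn (fun i => X i ω) {i | p i ω} t := fun y hy => by
        have := hts hy
        rwa [h] at this
      obtain ⟨s, hs, hbij⟩ := hsurj.exists_bijOn_subset
      have hsc : s.encard = m := by rw [← hbij.injOn.encard_image, hbij.image_eq, htc]
      have hfin : s.Finite := Set.finite_of_encard_eq_coe hsc
      refine ⟨⟨hfin.toFinset, ?_⟩, ?_, ?_⟩
      · rw [← Set.ncard_eq_toFinset_card s hfin, Set.ncard, hsc, ENat.toNat_natCast]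
      · exact fun i hi => hs (hfin.mem_toFinset.1 hi)
      · exact fun i hi j hj hne heq =>
          hne (hbij.injOn (hfin.mem_toFinset.1 hi) (hfin.mem_toFinset.1 hj) heq)
    · rintro ⟨⟨F, hF⟩, h1, h2⟩
      have hinj : Set.InjOn (fun i => X i ω) F := by
        intro i hi j hj hij
        by_contra hne
        exact h2 i hi j hj hne hij
      have hsub : (fun i => X i ω) '' F ⊆ S ω := by
        rintro _ ⟨i, hi, rfl⟩
        rw [h]
        exact ⟨i, h1 i hi, rfl⟩
      refine le_trans ?_ (Set.encard_le_encard hsub)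
      rw [hinj.encard_image, Set.encard_coe_eq_coe_finsetCard, hF]
  rw [heq]
  refine MeasurableSet.iUnion fun F => (Finset.measurableSet_biInter _ fun i _ => hp i).inter ?_
  refine Finset.measurableSet_biInter _ fun i _ => Finset.measurableSet_biInter _ fun j _ => ?_
  exact MeasurableSet.iInter fun _ => (measurableSet_eq_fun (hX i) (hX j)).compl

theorem Enumerated.measurableSet_encard_lt (hS : Enumerated S) (m : ℕ) :
    MeasurableSet {ω | (S ω).encard < (m : ℕ∞)} := by
  convert (hS.measurableSet_le_encard m).compl using 1
  ext ω
  simp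

theorem Enumerated.measurableSet_encard_eq (hS : Enumerated S) (m : ℕ) :
    MeasurableSet {ω | (S ω).encard = (m : ℕ∞)} := by
  convert (hS.measurableSet_le_encard m).inter (hS.measurableSet_encard_lt (m + 1)) using 1
  ext ω
  simp only [Set.mem_ofPred_eq, Set.mem_inter_iff]
  rw [le_antisymm_iff, and_comm]
  push_cast
  rw [ENat.lt_add_one_iff (by simp)]

theorem Enumerated.measurableSet_mem (hS : Enumerated S) {a : Ω → E} (ha : Measurable a) :
    MeasurableSet {ω | a ω ∈ S ω} := by
  obtain ⟨ι, _, X, p, hX, hp, h⟩ := hS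
  have : {ω | a ω ∈ S ω} = ⋃ i, ({ω | p i ω} ∩ {ω | X i ω = a ω}) := by
    ext ω
    simp [h]
  rw [this]
  exact MeasurableSet.iUnion fun i => (hp i).inter (measurableSet_eq_fun (hX i) ha)

theorem Enumerated.measurableSet_nearest (hS : Enumerated S) (k : ℕ) {a b : Ω → E}
    (ha : Measurable a) (hb : Measurable b) :
    MeasurableSet {ω | IsNearestNeighbor k (S ω) (a ω) (b ω)} := by
  refine (hS.measurableSet_mem hb).inter ((measurableSet_eq_fun hb ha).compl.inter ?_)
  refine Enumerated.measurableSet_encard_lt (hS.sep fun c hc => ?_) k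
  exact (measurableSet_eq_fun hc ha).compl.inter
    (measurableSet_lt (hc.dist ha) (hb.dist ha))

theorem Enumerated.neighborSet (hS : Enumerated S) (k : ℕ) {a : Ω → E} (ha : Measurable a) :
    Enumerated fun ω => (graph k (S ω)).neighborSet (a ω) := by
  have : (fun ω => (graph k (S ω)).neighborSet (a ω)) = fun ω => {y | y ∈ S ω ∧
      (graph k (S ω)).Adj (a ω) y} := by
    ext ω y
    exact ⟨fun h => ⟨h.2.1, h⟩, fun h => h.2⟩
  rw [this]
  refine hS.sep fun b hb => (hS.measurableSet_mem ha).inter ((hS.measurableSet_mem hb).inter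
    ((measurableSet_eq_fun ha hb).compl.inter
      ((hS.measurableSet_nearest k ha hb).union (hS.measurableSet_nearest k hb ha))))

theorem Enumerated.measurableSet_degree_eq (hS : Enumerated S) (k ℓ : ℕ) {a : Ω → E}
    (ha : Measurable a) : MeasurableSet {ω | degree k (S ω) (a ω) = (ℓ : ℕ∞)} :=
  (hS.neighborSet k ha).measurableSet_encard_eq ℓ

theorem Enumerated.measurable_vertexCount (hS : Enumerated S) (hfin : ∀ ω, (S ω).Finite)
    (k ℓ : ℕ) : Measurable fun ω => vertexCount k ℓ (S ω) := by
  refine measurable_to_countable' fun m => ?_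
  convert (hS.sep (q := fun ω y => degree k (S ω) y = (ℓ : ℕ∞))
    fun a ha => hS.measurableSet_degree_eq k ℓ ha).measurableSet_encard_eq m using 1
  ext ω
  simp only [Set.mem_preimage, Set.mem_singleton_iff, Set.mem_ofPred_eq, vertexCount]
  rw [← ((hfin ω).subset fun x hx => hx.1).cast_ncard_eq]
  norm_cast

end Measurability

section

variable {Ω E : Type*} [MeasurableSpace Ω] [NormedAddCommGroup E] [NormedSpace ℝ E]
  [MeasurableSpace E] [BorelSpace E] [SecondCountableTopology E] {S : Ω → Set E}

theorem measurableSet_cone (c : E) : MeasurableSet (cone c) := by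
  have : Measurable fun u : E => ‖‖u‖⁻¹ • u - c‖ := by fun_prop
  exact (measurableSet_singleton (0 : E)).compl.inter
    (measurableSet_lt this (measurable_const (a := (1 / 2 : ℝ))))

theorem Enumerated.measurableSet_filled (hS : Enumerated S) (k : ℕ) (T : Finset E) (r : ℝ) :
    MeasurableSet {ω | Filled k T r (S ω)} := by
  simp only [Filled, Set.ofPred_forall]
  exact Finset.measurableSet_biInter _ fun c _ => (hS.inter
    ((measurableSet_cone c).inter Metric.isClosed_closedBall.measurableSet)).measurableSet_le_encard k

end

/-! ### Product measures and bounded differences -/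

theorem measurePreserving_insertNth {E : Type*} [MeasurableSpace E] (μ : Measure E)
    [IsProbabilityMeasure μ] {n : ℕ} (i : Fin (n + 1)) :
    MeasurePreserving (fun p : E × (Fin n → E) => (i.insertNth p.1 p.2 : Fin (n + 1) → E))
      (μ.prod (Measure.pi fun _ => μ)) (Measure.pi fun _ => μ) :=
  (measurePreserving_piFinSuccAbove (fun _ : Fin (n + 1) => μ) i).symm _

theorem integrable_of_abs_le {Ω : Type*} [MeasurableSpace Ω] {P : Measure Ω} [IsFiniteMeasure P]
    {F : Ω → ℝ} {B : ℝ} (hF : Measurable F) (hB : ∀ x, |F x| ≤ B) : Integrable F P :=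
  .of_bound hF.aestronglyMeasurable B (ae_of_all _ hB)

/-- **McDiarmid's inequality** for the moment generating function, for functions that have bounded
differences on a set of full measure. -/
theorem integral_exp_le_of_bounded_differences {E : Type*} [MeasurableSpace E] (μ : Measure E)
    [IsProbabilityMeasure μ] {c B : ℝ} (hc : 0 ≤ c) (t : ℝ) (n : ℕ) :
    ∀ F : (Fin n → E) → ℝ, Measurable F → (∀ x, |F x| ≤ B) → ∀ G : Set (Fin n → E),
      (∀ᵐ x ∂Measure.pi fun _ => μ, x ∈ G) →
      (∀ i, ∀ x ∈ G, ∀ y ∈ G, (∀ j ≠ i, x j = y j) → |F x - F y| ≤ c) →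
      ∫ x, Real.exp (t * (F x - ∫ z, F z ∂Measure.pi fun _ => μ)) ∂(Measure.pi fun _ => μ) ≤
        Real.exp (n * (c ^ 2 * t ^ 2 / 2)) := by
  induction n with
  | zero =>
    intro F hF hB G hG hd
    have : ∀ x, F x = ∫ z, F z ∂Measure.pi fun _ => μ := by
      intro x
      rw [show F = fun _ => F x from funext fun y => by rw [Subsingleton.elim y x]]
      simp
    generalize (∫ z, F z ∂Measure.pi fun _ => μ) = m at this ⊢
    simp [this]
  | succ n ih =>
    intro F hF hB G hG hd
    set Q : Measure (Fin n → E) := Measure.pi fun _ => μ with hQ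
    have hmp : MeasurePreserving (fun p : E × (Fin n → E) => (Fin.cons p.1 p.2 : Fin (n + 1) → E))
        (μ.prod Q) (Measure.pi fun _ => μ) := by
      convert measurePreserving_insertNth μ (0 : Fin (n + 1)) using 2 with p
      exact (Fin.insertNth_zero' p.1 p.2).symm
    set F' : E → (Fin n → E) → ℝ := fun a y => F (Fin.cons a y) with hF'
    have hF'm : Measurable (Function.uncurry F') := hF.comp hmp.measurable
    have hB' : ∀ p, |Function.uncurry F' p| ≤ B := fun p => hB _
    have hF'a : ∀ a, Measurable (F' a) := fun a => hF'm.comp measurable_prodMk_left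
    set g : E → ℝ := fun a => ∫ y, F' a y ∂Q with hg
    have hgm : Measurable g := (hF'm.stronglyMeasurable.integral_prod_right).measurable
    have hB0 : 0 ≤ B := (abs_nonneg _).trans (hB (fun _ => μ.nonempty_of_neZero.some))
    have hgB : ∀ a, |g a| ≤ B := fun a => by
      have := norm_integral_le_of_norm_le_const (μ := Q) (f := F' a) (C := B)
        (ae_of_all _ fun y => hB _)
      simpa using this
    -- Split `F - m` into `F - g` and `g - m`, with `g` the mean given the first coordinate. The
    -- first part is handled by induction for fixed `a`, the second by Hoeffding's lemma.
    set m : ℝ := ∫ z, F z ∂Measure.pi fun _ => μ with hm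
    have hm' : m = ∫ a, g a ∂μ := by
      rw [hm, ← hmp.map_eq, integral_map hmp.measurable.aemeasurable hF.aestronglyMeasurable]
      exact integral_prod (Function.uncurry F') (integrable_of_abs_le hF'm hB')
    have hmB : |m| ≤ B := by
      have := norm_integral_le_of_norm_le_const (μ := μ) (f := g) (C := B)
        (ae_of_all _ fun y => hgB _)
      rw [hm']
      simpa using this
    have hexp : ∀ {Ω : Type _} [MeasurableSpace Ω] {P : Measure Ω} [IsFiniteMeasure P] {h : Ω → ℝ},
        Measurable h → (∀ x, |h x| ≤ 2 * B) → Integrable (fun x => Real.exp (t * h x)) P := by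
      intro Ω _ P _ h hh hhB
      refine integrable_of_abs_le (B := Real.exp (|t| * (2 * B))) (by fun_prop) fun x => ?_
      rw [abs_of_pos (Real.exp_pos _)]
      refine Real.exp_le_exp.2 ((le_abs_self _).trans ?_)
      rw [abs_mul]
      exact mul_le_mul_of_nonneg_left (hhB x) (abs_nonneg t)
    have hsub : ∀ {u v : ℝ}, |u| ≤ B → |v| ≤ B → |u - v| ≤ 2 * B := fun hu hv =>
      (abs_sub _ _).trans (by linarith)
    have hG' : ∀ᵐ a ∂μ, ∀ᵐ y ∂Q, (Fin.cons a y : Fin (n + 1) → E) ∈ G := by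
      have := hmp.quasiMeasurePreserving.ae hG
      exact Measure.ae_ae_of_ae_prod this
    have hosc : ∀ a, (∀ᵐ y ∂Q, (Fin.cons a y : Fin (n + 1) → E) ∈ G) →
        ∀ b, (∀ᵐ y ∂Q, (Fin.cons b y : Fin (n + 1) → E) ∈ G) → |g a - g b| ≤ c := by
      intro a ha b hb
      rw [hg]
      dsimp only
      rw [← integral_sub (integrable_of_abs_le (hF'a a) fun y => hB _)
        (integrable_of_abs_le (hF'a b) fun y => hB _)]
      have := norm_integral_le_of_norm_le_const (μ := Q) (f := fun y => F' a y - F' b y) (C := c) ?_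
      · simpa using this
      filter_upwards [ha, hb] with y hya hyb
      refine hd 0 _ hya _ hyb fun j hj => ?_
      obtain ⟨j, rfl⟩ := Fin.exists_succ_eq.2 hj
      simp
    -- Centring at one typical value `g a₀` confines `g` almost surely to an interval of length `2 *
    -- c`, so Hoeffding's lemma gives the variance proxy `c ^ 2`. The smaller constant from the
    -- essential range is not needed.
    obtain ⟨a₀, ha₀⟩ := hG'.exists
    have hhoef : ∫ a, Real.exp (t * (g a - m)) ∂μ ≤ Real.exp (c ^ 2 * t ^ 2 / 2) := by
      have := (hasSubgaussianMGF_of_mem_Icc (X := g) (μ := μ) (a := g a₀ - c) (b := g a₀ + c)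
        hgm.aemeasurable ?_).mgf_le t
      · rw [mgf, ← hm'] at this
        refine this.trans (Real.exp_le_exp.2 (le_of_eq ?_))
        have : ‖g a₀ + c - (g a₀ - c)‖ = 2 * c := by
          rw [Real.norm_eq_abs, abs_of_nonneg] <;> linarith
        push_cast
        rw [this]
        ring
      · filter_upwards [hG'] with a ha
        have := abs_le.1 (hosc a ha a₀ ha₀)
        exact ⟨by linarith, by linarith⟩
    have hmeas : Measurable fun x => Real.exp (t * (F x - m)) := by fun_prop
    rw [← hmp.map_eq, integral_map hmp.measurable.aemeasurable hmeas.aestronglyMeasurable]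
    have hint : Integrable (fun p : E × (Fin n → E) =>
        Real.exp (t * (Function.uncurry F' p - m))) (μ.prod Q) :=
      hexp (hF'm.sub_const m) fun p => hsub (hB' p) hmB
    refine (integral_prod _ hint).trans_le ?_
    calc ∫ a, ∫ y, Real.exp (t * (F' a y - m)) ∂Q ∂μ
        ≤ ∫ a, Real.exp (t * (g a - m)) * Real.exp (n * (c ^ 2 * t ^ 2 / 2)) ∂μ := by
          refine integral_mono_ae hint.integral_prod_left
            ((hexp (hgm.sub_const m) fun a => hsub (hgB a) hmB).mul_const _) ?_
          filter_upwards [hG'] with a ha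
          have e : ∀ y, Real.exp (t * (F' a y - m)) =
              Real.exp (t * (g a - m)) * Real.exp (t * (F' a y - g a)) := fun y => by
            rw [← Real.exp_add]
            ring_nf
          simp_rw [e]
          rw [integral_const_mul]
          refine mul_le_mul_of_nonneg_left ?_ (Real.exp_pos _).le
          refine ih (F' a) (hF'a a) (fun y => hB _) {y | (Fin.cons a y : Fin (n + 1) → E) ∈ G} ha ?_
          intro i x hx y hy hxy
          refine hd i.succ _ hx _ hy fun j hj => ?_
          refine Fin.cases (by simp) (fun j hj => ?_) j hj
          simpa using hxy j (fun h => hj (by rw [h]))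
      _ ≤ Real.exp (c ^ 2 * t ^ 2 / 2) * Real.exp (n * (c ^ 2 * t ^ 2 / 2)) := by
          rw [integral_mul_const]
          exact mul_le_mul_of_nonneg_right hhoef (Real.exp_pos _).le
      _ = Real.exp ((n + 1 : ℕ) * (c ^ 2 * t ^ 2 / 2)) := by
          rw [← Real.exp_add]
          push_cast
          ring_nf

/-- **McDiarmid's inequality** for functions that have bounded differences on a set of full
measure. -/
theorem measure_abs_sub_integral_ge_le {E : Type*} [MeasurableSpace E] (μ : Measure E)
    [IsProbabilityMeasure μ] {c B : ℝ} (hc : 0 < c) {n : ℕ} {F : (Fin n → E) → ℝ}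
    (hF : Measurable F) (hB : ∀ x, |F x| ≤ B) {G : Set (Fin n → E)}
    (hG : ∀ᵐ x ∂Measure.pi fun _ => μ, x ∈ G)
    (hd : ∀ i, ∀ x ∈ G, ∀ y ∈ G, (∀ j ≠ i, x j = y j) → |F x - F y| ≤ c) {ε : ℝ} (hε : 0 ≤ ε) :
    (Measure.pi fun _ : Fin n => μ).real
      {x | ε * n ≤ |F x - ∫ z, F z ∂Measure.pi fun _ => μ|} ≤
      2 * Real.exp (-(ε ^ 2 / (2 * c ^ 2)) * n) := by
  have key : ∀ H : (Fin n → E) → ℝ, Measurable H → (∀ x, |H x| ≤ B) →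
      (∀ i, ∀ x ∈ G, ∀ y ∈ G, (∀ j ≠ i, x j = y j) → |H x - H y| ≤ c) →
      (Measure.pi fun _ : Fin n => μ).real
        {x | ε * n ≤ H x - ∫ z, H z ∂Measure.pi fun _ => μ} ≤
        Real.exp (-(ε ^ 2 / (2 * c ^ 2)) * n) := by
    intro H hH hHB hHd
    set m := ∫ z, H z ∂Measure.pi fun _ => μ
    -- The minimizer of `-t * ε + c ^ 2 * t ^ 2 / 2`, the exponent per coordinate.
    set t := ε / c ^ 2 with ht
    have h1 := integral_exp_le_of_bounded_differences μ hc.le t n H hH hHB G hG hHd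
    have h2 := measure_ge_le_exp_mul_mgf (X := fun x => H x - m)
      (μ := Measure.pi fun _ : Fin n => μ) (ε * n) (t := t) (by positivity) ?_
    · refine h2.trans ((mul_le_mul_of_nonneg_left h1 (Real.exp_pos _).le).trans (le_of_eq ?_))
      rw [← Real.exp_add, ht]
      congr 1
      field_simp
      ring
    · refine integrable_of_abs_le (B := Real.exp (|t| * (B + |m|))) (by fun_prop) fun x => ?_
      rw [abs_of_pos (Real.exp_pos _)]
      refine Real.exp_le_exp.2 ((le_abs_self _).trans ?_)
      rw [abs_mul]
      exact mul_le_mul_of_nonneg_left ((abs_sub _ _).trans (by linarith [hHB x])) (abs_nonneg t)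
  have hsub : {x | ε * n ≤ |F x - ∫ z, F z ∂Measure.pi fun _ => μ|} ⊆
      {x | ε * n ≤ F x - ∫ z, F z ∂Measure.pi fun _ => μ} ∪
      {x | ε * n ≤ (-F x) - ∫ z, (-F z) ∂Measure.pi fun _ => μ} := by
    intro x hx
    rcases le_abs.1 (Set.mem_ofPred.1 hx) with h | h
    · exact Or.inl h
    · right
      rw [Set.mem_ofPred_eq, integral_neg]
      linarith
  refine (measureReal_mono hsub).trans ((measureReal_union_le _ _).trans ?_)
  have h1 := key F hF hB hd
  have h2 := key (fun x => -F x) hF.neg (fun x => by rw [abs_neg]; exact hB x)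
    fun i x hx y hy hxy => by
      rw [neg_sub_neg, abs_sub_comm]
      exact hd i x hx y hy hxy
  linarith

open scoped Nat

/-! ### Functionals of point configurations -/

theorem Enumerated.countable {Ω E : Type*} [MeasurableSpace Ω] [MeasurableSpace E]
    {S : Ω → Set E} (hS : Enumerated S) (ω : Ω) : (S ω).Countable := by
  obtain ⟨ι, _, X, p, -, -, h⟩ := hS
  refine (Set.countable_range fun i => X i ω).mono ?_
  rw [h]
  rintro _ ⟨i, -, rfl⟩
  exact ⟨i, rfl⟩

theorem Enumerated.union {Ω E : Type*} [MeasurableSpace Ω] [MeasurableSpace E]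
    {S R : Ω → Set E} (hS : Enumerated S) (hR : Enumerated R) :
    Enumerated fun ω => S ω ∪ R ω := by
  have := Enumerated.iUnion (κ := Bool) (S := fun b => bif b then S else R)
    (by rintro (_ | _) <;> assumption)
  convert this using 2 with ω
  ext y
  simp [or_comm]

theorem enumerated_const {Ω E : Type*} [MeasurableSpace Ω] [MeasurableSpace E]
    {S : Set E} (hS : S.Countable) : Enumerated fun _ : Ω => S := by
  rcases S.eq_empty_or_nonempty with rfl | hne
  · exact ⟨Empty, inferInstance, fun i => i.elim, fun i => i.elim, fun i => i.elim,
      fun i => i.elim, fun _ => by simp⟩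
  · obtain ⟨f, rfl⟩ := hS.exists_eq_range hne
    exact ⟨ℕ, inferInstance, fun i _ => f i, fun _ _ => True, fun i => measurable_const,
      fun _ => MeasurableSet.univ, fun _ => by ext; simp⟩

theorem enumerated_singleton {E : Type*} [MeasurableSpace E] : Enumerated fun x : E => ({x} : Set E) :=
  ⟨Unit, inferInstance, fun _ x => x, fun _ _ => True, fun _ => measurable_id,
    fun _ => MeasurableSet.univ, fun x => by ext; simp [eq_comm]⟩

/-- Countable point configurations. -/
abbrev Config (E : Type) := {S : Set E // S.Countable}

/-- The nonnegative functionals of point configurations that are measurable along enumerated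
random sets. -/
def measurableFunctionals (E : Type) [MeasurableSpace E] : Submodule ℝ≥0∞ (Config E → ℝ≥0∞) where
  carrier := {G | ∀ (Ω : Type) [MeasurableSpace Ω] (S : Ω → Config E),
    (Enumerated fun ω => (S ω).1) → Measurable fun ω => G (S ω)}
  add_mem' h1 h2 := fun Ω _ S hS => (h1 Ω S hS).add (h2 Ω S hS)
  zero_mem' := fun _ _ _ _ => measurable_const
  smul_mem' c _ h := fun Ω _ S hS => (h Ω S hS).const_mul c

variable {E : Type} [MeasurableSpace E]

/-- Taking the mean of a functional after adding the random set `R` to the configuration. -/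
def unionOp {Ω : Type} [MeasurableSpace Ω] (Q : Measure Ω) [SFinite Q] {R : Ω → Set E}
    (hR : Enumerated R) : Module.End ℝ≥0∞ (measurableFunctionals E) where
  toFun G := ⟨fun S => ∫⁻ ω, G.1 ⟨S.1 ∪ R ω, S.2.union (hR.countable ω)⟩ ∂Q, by
    intro Ω' _ S hS
    exact Measurable.lintegral_prod_right' (f := fun p : Ω' × Ω => G.1 ⟨(S p.1).1 ∪ R p.2,
      (S p.1).2.union (hR.countable p.2)⟩) (G.2 (Ω' × Ω) _
        ((hS.comp measurable_fst).union (hR.comp measurable_snd)))⟩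
  map_add' G H := by
    ext S
    exact lintegral_add_left (G.2 Ω _ ((enumerated_const S.2).union hR)) _
  map_smul' c G := by
    ext S
    exact lintegral_const_mul c (G.2 Ω _ ((enumerated_const S.2).union hR))

theorem unionOp_apply {Ω : Type} [MeasurableSpace Ω] (Q : Measure Ω) [SFinite Q] {R : Ω → Set E}
    (hR : Enumerated R) (G : measurableFunctionals E) (S : Config E) :
    (unionOp Q hR G).1 S = ∫⁻ ω, G.1 ⟨S.1 ∪ R ω, S.2.union (hR.countable ω)⟩ ∂Q := rfl

/-- Tonelli's theorem and the commutativity of unions. This permits binomial and exponential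
expansions of sums of these operators. -/
theorem unionOp_commute {Ω Ω' : Type} [MeasurableSpace Ω] [MeasurableSpace Ω'] (Q : Measure Ω)
    [SFinite Q] (Q' : Measure Ω') [SFinite Q'] {R : Ω → Set E} {R' : Ω' → Set E}
    (hR : Enumerated R) (hR' : Enumerated R') : Commute (unionOp Q hR) (unionOp Q' hR') := by
  ext G S
  simp only [Module.End.mul_apply, unionOp_apply]
  rw [lintegral_lintegral_swap]
  · simp only [Set.union_right_comm]
  · exact (G.2 (Ω × Ω') (fun p => ⟨(S.1 ∪ R p.1) ∪ R' p.2, _⟩)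
      (((enumerated_const S.2).union (hR.comp measurable_fst)).union
        (hR'.comp measurable_snd))).aemeasurable

/-- Integrating over the position of an additional point. -/
def addPoint (μ : Measure E) [SFinite μ] : Module.End ℝ≥0∞ (measurableFunctionals E) :=
  unionOp μ enumerated_singleton

theorem addPoint_apply (μ : Measure E) [SFinite μ] (G : measurableFunctionals E) (S : Config E) :
    (addPoint μ G).1 S = ∫⁻ x, G.1 ⟨S.1 ∪ {x}, S.2.union (Set.countable_singleton x)⟩ ∂μ := rfl

/-- Intersecting the configuration with a measurable window. -/
def window {W : Set E} (hW : MeasurableSet W) : Module.End ℝ≥0∞ (measurableFunctionals E) where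
  toFun G := ⟨fun S => G.1 ⟨S.1 ∩ W, S.2.mono Set.inter_subset_left⟩, fun Ω _ S hS =>
    G.2 Ω (fun ω => ⟨(S ω).1 ∩ W, _⟩) (hS.inter hW)⟩
  map_add' _ _ := rfl
  map_smul' _ _ := rfl

theorem window_apply {W : Set E} (hW : MeasurableSet W) (G : measurableFunctionals E)
    (S : Config E) :
    (window hW G).1 S = G.1 ⟨S.1 ∩ W, S.2.mono Set.inter_subset_left⟩ := rfl

/-- An added point either falls into `W` and is seen, or falls outside and leaves only the factor `μ
Wᶜ`. -/
theorem addPoint_mul_window (μ : Measure E) [SFinite μ] {W : Set E} (hW : MeasurableSet W) :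
    addPoint μ * window hW = window hW * (addPoint (μ.restrict W) + μ Wᶜ • 1) := by
  ext G S
  simp only [Module.End.mul_apply, window_apply, LinearMap.add_apply, LinearMap.smul_apply,
    Module.End.one_apply, addPoint_apply, Submodule.coe_add, Submodule.coe_smul, Pi.add_apply,
    Pi.smul_apply, smul_eq_mul]
  rw [← lintegral_add_compl _ hW]
  congr 1
  · refine setLIntegral_congr_fun hW fun x hx => ?_
    refine congrArg G.1 (Subtype.ext ?_)
    dsimp only
    rw [Set.union_inter_distrib_right, Set.inter_eq_left.2 (Set.singleton_subset_iff.2 hx)]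
  · rw [mul_comm, ← setLIntegral_const]
    refine setLIntegral_congr_fun hW.compl fun x hx => ?_
    refine congrArg G.1 (Subtype.ext ?_)
    dsimp only
    rw [Set.union_inter_distrib_right, Set.singleton_inter_eq_empty.2 hx, Set.union_empty]

/-! ### Binomial processes as powers of `addPoint`. -/

theorem lintegral_pi_eq (μ : Measure E) [IsProbabilityMeasure μ] (m : ℕ) :
    ∀ (G : measurableFunctionals E) (S : Config E),
      ∫⁻ x, G.1 ⟨S.1 ∪ Set.range x, S.2.union (Set.countable_range x)⟩
        ∂(Measure.pi fun _ : Fin m => μ) = ((addPoint μ ^ m) G).1 S := by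
  induction m with
  | zero => intro G S; simp
  | succ m ih =>
    intro G S
    have hmp := measurePreserving_insertNth μ (0 : Fin (m + 1))
    have hmeas : Measurable fun x : Fin (m + 1) → E =>
        G.1 ⟨S.1 ∪ Set.range x, S.2.union (Set.countable_range x)⟩ :=
      G.2 _ (fun x : Fin (m + 1) → E => ⟨S.1 ∪ Set.range x, _⟩)
        ((enumerated_const S.2).union (enumerated_range _))
    rw [← hmp.lintegral_comp hmeas, ← Function.comp_def (fun x : Fin (m + 1) → E =>
      G.1 ⟨S.1 ∪ Set.range x, S.2.union (Set.countable_range x)⟩),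
      lintegral_prod_symm _ (hmeas.comp hmp.measurable).aemeasurable, pow_succ, Module.End.mul_apply, ← ih]
    refine lintegral_congr fun y => ?_
    rw [addPoint_apply]
    refine lintegral_congr fun a => ?_
    refine congrArg G.1 (Subtype.ext ?_)
    dsimp only
    rw [Fin.insertNth_zero', Fin.range_cons, Set.insert_eq, Set.union_assoc,
      Set.union_comm {a}]

/-- Move the window to the left past all `n` factors, then expand by the binomial theorem; the index
`m` is the number of points in `W`. -/
theorem lintegral_pi_inter_eq (μ : Measure E) [IsProbabilityMeasure μ] {W : Set E}
    (hW : MeasurableSet W) (n : ℕ) (G : measurableFunctionals E) :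
    ∫⁻ x, G.1 ⟨Set.range x ∩ W, (Set.countable_range x).mono Set.inter_subset_left⟩
        ∂(Measure.pi fun _ : Fin n => μ) =
      ∑ m ∈ Finset.range (n + 1), n.choose m * (μ Wᶜ) ^ (n - m) *
        ((addPoint (μ.restrict W) ^ m) G).1 ⟨∅, Set.countable_empty⟩ := by
  have h1 := lintegral_pi_eq μ n (window hW G) ⟨∅, Set.countable_empty⟩
  have h2 : addPoint μ ^ n * window hW =
      window hW * (addPoint (μ.restrict W) + μ Wᶜ • 1) ^ n :=
    (SemiconjBy.pow_right (a := window hW) (addPoint_mul_window μ hW).symm n).symm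
  have h3 : Commute (addPoint (μ.restrict W)) (μ Wᶜ • (1 : Module.End ℝ≥0∞ _)) :=
    (Commute.one_right _).smul_right _
  rw [← Module.End.mul_apply, h2, Module.End.mul_apply, window_apply, h3.add_pow] at h1
  simp only [window_apply, Set.empty_union, Set.empty_inter] at h1
  rw [h1]
  simp only [LinearMap.sum_apply, AddSubmonoidClass.coe_finsetSum, Finset.sum_apply]
  refine Finset.sum_congr rfl fun m _ => ?_
  rw [smul_pow, one_pow, mul_smul_comm, mul_one, ← nsmul_eq_mul', LinearMap.smul_apply,
    LinearMap.smul_apply, mul_assoc, ← nsmul_eq_mul]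
  rfl

/-! ### Poisson processes -/

theorem measurePreserving_infinitePi_fin {E : Type*} [MeasurableSpace E] (μ : Measure E)
    [IsProbabilityMeasure μ] (m : ℕ) :
    MeasurePreserving (fun (X : ℕ → E) (i : Fin m) => X i) (Measure.infinitePi fun _ => μ)
      (Measure.pi fun _ => μ) := by
  refine ⟨by fun_prop, ?_⟩
  have h : iIndepFun (fun (i : ℕ) (X : ℕ → E) => X i) (Measure.infinitePi fun _ => μ) :=
    iIndepFun_infinitePi (X := fun _ x => x) (fun _ => measurable_id)
  have h2 := h.precomp (g := fun i : Fin m => (i : ℕ)) Fin.val_injective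
  rw [(iIndepFun_iff_map_fun_eq_pi_map fun i => (measurable_pi_apply _).aemeasurable).1 h2]
  congr 1
  ext1 i
  exact (measurePreserving_eval_infinitePi _ _).map_eq

theorem lintegral_poissonLaw {E : Type*} [MeasurableSpace E] (ν : ℝ≥0) (μ : Measure E)
    [IsProbabilityMeasure μ] {g : Set E → ℝ≥0∞}
    (hg : Measurable fun ω : ℕ × (ℕ → E) => g (pointSet ω))
    (hg' : ∀ m : ℕ, Measurable fun x : Fin m → E => g (Set.range x)) :
    ∫⁻ ω, g (pointSet ω) ∂poissonLaw ν μ =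
      ∑' m : ℕ, poissonMeasure ν {m} *
        ∫⁻ x, g (Set.range x) ∂(Measure.pi fun _ : Fin m => μ) := by
  rw [poissonLaw, lintegral_prod _ hg.aemeasurable, lintegral_countable']
  refine tsum_congr fun m => ?_
  rw [mul_comm, ← (measurePreserving_infinitePi_fin μ m).lintegral_comp (hg' m)]
  congr 1
  refine lintegral_congr fun X => ?_
  congr 1
  ext y
  simp only [pointSet, Set.mem_image, Set.mem_range, Set.mem_ofPred_eq]
  constructor
  · rintro ⟨i, hi, rfl⟩
    exact ⟨⟨i, hi⟩, rfl⟩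
  · rintro ⟨i, rfl⟩
    exact ⟨i, i.2, rfl⟩

theorem unionOp_poissonLaw_one (μ : Measure E) [IsProbabilityMeasure μ]
    (G : measurableFunctionals E) (S : Config E) :
    (unionOp (poissonLaw 1 μ) enumerated_pointSet G).1 S =
      ENNReal.ofReal (Real.exp (-1)) * ∑' m : ℕ, (m ! : ℝ≥0∞)⁻¹ * ((addPoint μ ^ m) G).1 S := by
  classical
  rw [unionOp_apply]
  -- `lintegral_poissonLaw` needs a function of all sets; the value `0` on uncountable ones never
  -- occurs.
  let g : Set E → ℝ≥0∞ := fun A => if h : A.Countable then G.1 ⟨S.1 ∪ A, S.2.union h⟩ else 0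
  have hg : ∀ A (h : A.Countable), g A = G.1 ⟨S.1 ∪ A, S.2.union h⟩ := fun A h => dif_pos h
  have h1 : ∀ {Ω : Type} [MeasurableSpace Ω] {R : Ω → Set E}, Enumerated R →
      Measurable fun ω => g (R ω) := by
    intro Ω _ R hR
    simp_rw [fun ω => hg (R ω) (hR.countable ω)]
    exact G.2 Ω (fun ω => ⟨S.1 ∪ R ω, _⟩) ((enumerated_const S.2).union hR)
  have h2 := lintegral_poissonLaw 1 μ (h1 enumerated_pointSet) fun m => h1 (enumerated_range m)
  simp_rw [fun ω => hg _ (enumerated_pointSet.countable (E := E) ω)] at h2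
  rw [h2, ← ENNReal.tsum_mul_left]
  refine tsum_congr fun m => ?_
  simp_rw [fun x : Fin m → E => hg _ (Set.countable_range x)]
  rw [lintegral_pi_eq, ← mul_assoc, poissonMeasure_singleton]
  congr 1
  simp only [NNReal.coe_one, one_pow, mul_one]
  rw [ENNReal.ofReal_div_of_pos (by positivity), ENNReal.ofReal_natCast, div_eq_mul_inv]

/-- The identity `exp (A + B) = exp A * exp B` for commuting operators, evaluated at a
configuration. With values in `ℝ≥0∞` the double series may be rearranged freely. -/
theorem tsum_add_pow {E : Type} {M : Submodule ℝ≥0∞ (Config E → ℝ≥0∞)} {A B : Module.End ℝ≥0∞ M}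
    (hAB : Commute A B) (G : M) (S : Config E) :
    ∑' n : ℕ, (n ! : ℝ≥0∞)⁻¹ * (((A + B) ^ n) G).1 S =
      ∑' m : ℕ, (m ! : ℝ≥0∞)⁻¹ * ∑' j : ℕ, (j ! : ℝ≥0∞)⁻¹ * ((A ^ j) ((B ^ m) G)).1 S := by
  have h0 : ∀ n : ℕ, (n ! : ℝ≥0∞) ≠ 0 := fun n => by exact_mod_cast n.factorial_ne_zero
  simp_rw [← ENNReal.tsum_mul_left]
  rw [ENNReal.tsum_comm, ← ENNReal.tsum_prod (f := fun j m => (m ! : ℝ≥0∞)⁻¹ *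
      ((j ! : ℝ≥0∞)⁻¹ * ((A ^ j) ((B ^ m) G)).1 S)),
    ← (Finset.HasAntidiagonal.sigmaAntidiagonalEquivProd (A := ℕ)).tsum_eq, ENNReal.tsum_sigma']
  refine tsum_congr fun n => ?_
  rw [hAB.add_pow', tsum_fintype, Finset.univ_eq_attach, LinearMap.sum_apply,
    AddSubmonoidClass.coe_finsetSum, Finset.sum_apply, Finset.mul_sum, ← Finset.sum_attach]
  refine Finset.sum_congr rfl fun ij _ => ?_
  obtain ⟨⟨i, j⟩, hij⟩ := ij
  rw [Finset.HasAntidiagonal.mem_antidiagonal] at hij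
  subst hij
  have hc0 : ((i + j).choose i : ℝ≥0∞) ≠ 0 := by
    exact_mod_cast (Nat.choose_pos (Nat.le_add_right i j)).ne'
  have h : ((i + j)! : ℝ≥0∞)⁻¹ * ((i + j).choose i : ℝ≥0∞) = (j ! : ℝ≥0∞)⁻¹ * (i ! : ℝ≥0∞)⁻¹ := by
    rw [← Nat.add_choose_mul_factorial_mul_factorial i j]
    push_cast
    rw [ENNReal.mul_inv (Or.inr (by simp)) (Or.inr (h0 j)),
      ENNReal.mul_inv (Or.inr (by simp)) (Or.inr (h0 i)), mul_comm, ← mul_assoc, ← mul_assoc,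
      ← Nat.choose_symm_add, ENNReal.mul_inv_cancel hc0 (by simp), one_mul, mul_comm]
  rw [LinearMap.smul_apply]
  change ((i + j)! : ℝ≥0∞)⁻¹ * ((i + j).choose i • ((A ^ i) ((B ^ j) G)).1 S) =
    (j ! : ℝ≥0∞)⁻¹ * ((i ! : ℝ≥0∞)⁻¹ * ((A ^ i) ((B ^ j) G)).1 S)
  rw [nsmul_eq_mul, ← mul_assoc, h, mul_assoc]

/-- The superposition of independent Poisson processes of unit mass. -/
theorem lmarginal_poissonLaw {ι : Type} [DecidableEq ι] (μ : ι → Measure E)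
    [∀ z, IsProbabilityMeasure (μ z)] (F : Finset ι) :
    ∀ (G : measurableFunctionals E) (S : Config E) (x : ι → ℕ × (ℕ → E)),
      lmarginal (fun z => poissonLaw 1 (μ z)) F (fun ω => G.1 ⟨S.1 ∪ ⋃ z ∈ F, pointSet (ω z),
        S.2.union (F.countable_toSet.biUnion fun z _ => enumerated_pointSet.countable (ω z))⟩) x =
      ENNReal.ofReal (Real.exp (-1)) ^ F.card *
        ∑' m : ℕ, (m ! : ℝ≥0∞)⁻¹ * (((∑ z ∈ F, addPoint (μ z)) ^ m) G).1 S := by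
  induction F using Finset.induction_on with
  | empty =>
    intro G S x
    rw [lmarginal_empty, tsum_eq_single 0]
    · simp
    · intro m hm
      simp [hm]
  | insert a F ha ih =>
    intro G S x
    have hmeas : Measurable fun ω : ι → ℕ × (ℕ → E) =>
        G.1 ⟨S.1 ∪ ⋃ z ∈ insert a F, pointSet (ω z), S.2.union
          ((insert a F).countable_toSet.biUnion fun z _ => enumerated_pointSet.countable (ω z))⟩ := by
      refine G.2 (ι → ℕ × (ℕ → E)) (fun ω => ⟨_, _⟩) ((enumerated_const S.2).union ?_)
      have := Enumerated.iUnion (κ := (insert a F : Finset ι))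
        (S := fun z (ω : ι → ℕ × (ℕ → E)) => pointSet (ω z))
        fun z => enumerated_pointSet.comp (measurable_pi_apply z.1)
      convert this using 2 with ω
      ext y
      simp
    rw [lmarginal_insert' _ hmeas ha]
    have hcomm : Commute (∑ z ∈ F, addPoint (μ z))
        (unionOp (poissonLaw 1 (μ a)) enumerated_pointSet) :=
      Commute.sum_left _ _ _ fun z _ => unionOp_commute _ _ _ _
    have hcomm' : Commute (addPoint (μ a)) (∑ z ∈ F, addPoint (μ z)) :=
      Commute.sum_right _ _ _ fun z _ => unionOp_commute _ _ _ _
    -- The process with index `a` is averaged out first and absorbed into the functional.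
    -- Commutation then carries its exponential series to the front.
    have h := ih (unionOp (poissonLaw 1 (μ a)) enumerated_pointSet G) S x
    rw [Finset.sum_insert ha, Finset.card_insert_of_notMem ha, tsum_add_pow hcomm']
    have h2 : ∀ m : ℕ, (((∑ z ∈ F, addPoint (μ z)) ^ m)
        (unionOp (poissonLaw 1 (μ a)) enumerated_pointSet G)).1 S =
        ENNReal.ofReal (Real.exp (-1)) * ∑' j : ℕ, (j ! : ℝ≥0∞)⁻¹ *
          ((addPoint (μ a) ^ j) (((∑ z ∈ F, addPoint (μ z)) ^ m) G)).1 S := by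
      intro m
      rw [← unionOp_poissonLaw_one, ← Module.End.mul_apply, (hcomm.pow_left m).eq,
        Module.End.mul_apply]
    simp_rw [h2, mul_left_comm _ (ENNReal.ofReal (Real.exp (-1)))] at h
    rw [ENNReal.tsum_mul_left, ← mul_assoc, ← pow_succ] at h
    rw [← h]
    congr 1
    ext ω
    rw [unionOp_apply]
    refine lintegral_congr fun p => ?_
    refine congrArg G.1 (Subtype.ext ?_)
    dsimp only
    rw [Finset.set_biUnion_insert, Function.update_self, Set.union_assoc,
      Set.union_comm (pointSet p)]
    congr 2
    refine Set.iUnion₂_congr fun z hz => ?_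
    rw [Function.update_of_ne (ne_of_mem_of_not_mem hz ha)]

/-! ### Convergence of binomial processes to Poisson processes -/

section Limit

variable {E : Type} [MeasurableSpace E]

/-- Supplies the bound, uniform in the configuration, that controls the error in the induction of
`addPoint_pow_le_liminf`. -/
theorem pow_mul_addPoint_pow_le (μ : Measure E) [SFinite μ] {a C : ℝ≥0∞}
    (hC : a * μ Set.univ ≤ C) (G : measurableFunctionals E) (hG : ∀ S, G.1 S ≤ 1) (m : ℕ) :
    ∀ S, a ^ m * ((addPoint μ ^ m) G).1 S ≤ C ^ m := by
  induction m with
  | zero => intro S; simpa using hG S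
  | succ m ih =>
    intro S
    rw [pow_succ' (addPoint μ), Module.End.mul_apply, addPoint_apply, pow_succ' a, mul_assoc,
      ← lintegral_const_mul _ (((addPoint μ ^ m) G).2 E (fun x => ⟨S.1 ∪ {x}, _⟩)
      ((enumerated_const S.2).union enumerated_singleton))]
    calc _ ≤ a * ∫⁻ _, C ^ m ∂μ := by
          gcongr with x
          exact ih _
      _ = (a * μ Set.univ) * C ^ m := by rw [lintegral_const]; ring
      _ ≤ C ^ (m + 1) := by rw [pow_succ']; gcongr

/-- Each induction step applies Fatou's lemma under the fixed measure `lam`, and only then replaces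
`lam` by `n • μ n`, at a cost of at most `C ^ m * ε n`. -/
theorem addPoint_pow_le_liminf {μ : ℕ → Measure E} [∀ n, SFinite (μ n)] {lam : Measure E}
    [SFinite lam] {ε : ℕ → ℝ≥0∞} (hε : Tendsto ε atTop (𝓝 0)) {C : ℝ≥0∞} (hC' : C ≠ ∞)
    (hC : ∀ᶠ n : ℕ in atTop, n * μ n Set.univ ≤ C)
    (hle : ∀ᶠ n : ℕ in atTop, ∀ h : E → ℝ≥0∞, Measurable h → ∀ B : ℝ≥0∞, (∀ x, h x ≤ B) →
      ∫⁻ x, h x ∂lam ≤ n * ∫⁻ x, h x ∂μ n + B * ε n)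
    (G : measurableFunctionals E) (hG : ∀ S, G.1 S ≤ 1) (m : ℕ) :
    ∀ S, ((addPoint lam ^ m) G).1 S ≤
      liminf (fun n : ℕ => (n : ℝ≥0∞) ^ m * ((addPoint (μ n) ^ m) G).1 S) atTop := by
  induction m with
  | zero => intro S; simp
  | succ m ih =>
    intro S
    let h : ℕ → E → ℝ≥0∞ := fun n x => (n : ℝ≥0∞) ^ m *
      ((addPoint (μ n) ^ m) G).1 ⟨S.1 ∪ {x}, S.2.union (Set.countable_singleton x)⟩
    have hm' : ∀ n, Measurable fun x => ((addPoint (μ n) ^ m) G).1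
        ⟨S.1 ∪ {x}, S.2.union (Set.countable_singleton x)⟩ := fun n =>
      ((addPoint (μ n) ^ m) G).2 E (fun x => ⟨S.1 ∪ {x}, _⟩)
        ((enumerated_const S.2).union enumerated_singleton)
    have hm : ∀ n, Measurable (h n) := fun n => (hm' n).const_mul _
    have h0 : Tendsto (fun n => C ^ m * ε n) atTop (𝓝 0) := by
      simpa using ENNReal.Tendsto.const_mul hε (Or.inr (ENNReal.pow_ne_top hC'))
    rw [pow_succ' (addPoint lam), Module.End.mul_apply, addPoint_apply]
    calc _ ≤ ∫⁻ x, liminf (fun n => h n x) atTop ∂lam := lintegral_mono fun x => ih _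
      _ ≤ liminf (fun n => ∫⁻ x, h n x ∂lam) atTop := lintegral_liminf_le hm
      _ ≤ liminf ((fun n : ℕ => n * ∫⁻ x, h n x ∂μ n) + fun n => C ^ m * ε n) atTop := by
          refine liminf_le_liminf ?_
          filter_upwards [hC, hle] with n hn1 hn2
          exact hn2 _ (hm n) _ fun x => pow_mul_addPoint_pow_le (μ n) hn1 G hG m _
      _ = liminf (fun n : ℕ => n * ∫⁻ x, h n x ∂μ n) atTop :=
          ENNReal.liminf_add_of_right_tendsto_zero h0 _
      _ = _ := by
          congr 1
          ext n
          rw [pow_succ' (addPoint (μ n)), Module.End.mul_apply, addPoint_apply,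
            lintegral_const_mul _ (hm' n), pow_succ', mul_assoc]

theorem tendsto_ofReal_choose_mul {p : ℕ → ℝ} {c : ℝ}
    (hp : Tendsto (fun n : ℕ => n * p n) atTop (𝓝 c)) (m : ℕ) :
    Tendsto (fun n : ℕ => ENNReal.ofReal (n.choose m * (1 / (n : ℝ)) ^ m * (1 - p n) ^ n)) atTop
      (𝓝 (ENNReal.ofReal (Real.exp (-c)) * (m ! : ℝ≥0∞)⁻¹)) := by
  have h1 : Tendsto (fun n : ℕ => n.choose m * (1 / (n : ℝ)) ^ m) atTop (𝓝 (1 ^ m / m !)) := by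
    refine tendsto_choose_mul_pow_atTop m (tendsto_const_nhds.congr' ?_)
    filter_upwards [eventually_ge_atTop 1] with n hn
    field_simp
  have h2 : Tendsto (fun n : ℕ => (1 - p n) ^ n) atTop (𝓝 (Real.exp (-c))) := by
    simpa [sub_eq_add_neg] using Real.tendsto_one_add_pow_exp_of_tendsto (g := fun n => -p n)
      (t := -c) (by simpa using hp.neg)
  convert ENNReal.tendsto_ofReal (h1.mul h2) using 2
  rw [one_pow, ENNReal.ofReal_mul (by positivity), one_div, mul_comm,
    ENNReal.ofReal_inv_of_pos (by positivity), ENNReal.ofReal_natCast]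

/-- The weights of the binomial expansion converge as in the Poisson limit theorem and the iterated
integrals are handled by `addPoint_pow_le_liminf`. Fatou's lemma for counting measure sums over the
number of points, so no domination of the series is required. -/
theorem poisson_le_liminf_binomial {μ : ℕ → Measure E} [∀ n, IsProbabilityMeasure (μ n)]
    {W : Set E} (hW : MeasurableSet W) {lam : Measure E} [IsFiniteMeasure lam]
    {ε : ℕ → ℝ≥0∞} (hε : Tendsto ε atTop (𝓝 0))
    (hmass : Tendsto (fun n : ℕ => n * (μ n).real W) atTop (𝓝 (lam.real Set.univ)))
    (hle : ∀ᶠ n : ℕ in atTop, ∀ h : E → ℝ≥0∞, Measurable h → ∀ B : ℝ≥0∞, (∀ x, h x ≤ B) →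
      ∫⁻ x, h x ∂lam ≤ n * ∫⁻ x in W, h x ∂μ n + B * ε n)
    (G : measurableFunctionals E) (hG : ∀ S, G.1 S ≤ 1) :
    ENNReal.ofReal (Real.exp (-lam.real Set.univ)) * ∑' m : ℕ, (m ! : ℝ≥0∞)⁻¹ *
        ((addPoint lam ^ m) G).1 ⟨∅, Set.countable_empty⟩ ≤
      liminf (fun n : ℕ => ∫⁻ x, G.1 ⟨Set.range x ∩ W,
        (Set.countable_range x).mono Set.inter_subset_left⟩
          ∂(Measure.pi fun _ : Fin n => μ n)) atTop := by
  let S₀ : Config E := ⟨∅, Set.countable_empty⟩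
  -- The exponent `n` replaces the exact `n - m`. This only lowers the term and makes the limit of
  -- the weight immediate; terms with `m > n` vanish.
  let t : ℕ → ℕ → ℝ≥0∞ := fun n m =>
    ENNReal.ofReal (n.choose m * (1 / (n : ℝ)) ^ m * (1 - (μ n).real W) ^ n) *
      ((n : ℝ≥0∞) ^ m * ((addPoint ((μ n).restrict W) ^ m) G).1 S₀)
  have hC : ∀ᶠ n : ℕ in atTop, n * (μ n).restrict W Set.univ ≤
      ENNReal.ofReal (lam.real Set.univ + 1) := by
    filter_upwards [hmass.eventually (eventually_le_nhds (lt_add_one _))] with n hn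
    rw [Measure.restrict_apply_univ, ← ENNReal.ofReal_natCast, ← ofReal_measureReal,
      ← ENNReal.ofReal_mul (by positivity)]
    exact ENNReal.ofReal_le_ofReal hn
  have hlim : ∀ m, ENNReal.ofReal (Real.exp (-lam.real Set.univ)) * ((m ! : ℝ≥0∞)⁻¹ *
      ((addPoint lam ^ m) G).1 S₀) ≤ liminf (fun n => t n m) atTop := by
    intro m
    have h1 := tendsto_ofReal_choose_mul hmass m
    rw [← mul_assoc]
    refine le_trans ?_ ENNReal.le_liminf_mul
    rw [h1.liminf_eq]
    gcongr
    exact addPoint_pow_le_liminf hε ENNReal.ofReal_ne_top hC hle G hG m S₀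
  have hsum : ∀ᶠ n : ℕ in atTop, ∑' m, t n m ≤ ∫⁻ x, G.1 ⟨Set.range x ∩ W,
        (Set.countable_range x).mono Set.inter_subset_left⟩
          ∂(Measure.pi fun _ : Fin n => μ n) := by
    filter_upwards [eventually_ge_atTop 1] with n hn
    rw [lintegral_pi_inter_eq (μ n) hW n G, tsum_eq_sum (s := Finset.range (n + 1))]
    · refine Finset.sum_le_sum fun m hm => ?_
      have hq : μ n Wᶜ = ENNReal.ofReal (1 - (μ n).real W) := by
        rw [← probReal_compl_eq_one_sub hW, ofReal_measureReal]
      have hq1 : 1 - (μ n).real W ≤ 1 := by linarith [measureReal_nonneg (μ := μ n) (s := W)]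
      have hq0 : 0 ≤ 1 - (μ n).real W := by linarith [measureReal_le_one (μ := μ n) (s := W)]
      have hn0 : (n : ℝ≥0∞) ≠ 0 := by exact_mod_cast (by omega : n ≠ 0)
      have e1 : ENNReal.ofReal ((1 / (n : ℝ)) ^ m) * (n : ℝ≥0∞) ^ m = 1 := by
        rw [ENNReal.ofReal_pow (by positivity), one_div,
          ENNReal.ofReal_inv_of_pos (by exact_mod_cast hn), ENNReal.ofReal_natCast, ← mul_pow,
          ENNReal.inv_mul_cancel hn0 (by simp), one_pow]
      simp only [t]
      rw [ENNReal.ofReal_mul (by positivity), ENNReal.ofReal_mul (by positivity),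
        ENNReal.ofReal_natCast, ENNReal.ofReal_pow hq0, ← hq]
      calc _ = (n.choose m : ℝ≥0∞) * (ENNReal.ofReal ((1 / (n : ℝ)) ^ m) * (n : ℝ≥0∞) ^ m) *
            (μ n Wᶜ) ^ n * ((addPoint ((μ n).restrict W) ^ m) G).1 S₀ := by ring
        _ ≤ _ := by
          rw [e1, mul_one]
          exact mul_le_mul' (mul_le_mul' le_rfl
            (pow_le_pow_right_of_le_one' (prob_le_one (μ := μ n)) (Nat.sub_le n m))) le_rfl
    · intro m hm
      rw [Finset.mem_range, not_lt] at hm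
      simp [t, Nat.choose_eq_zero_of_lt (Nat.lt_of_succ_le hm)]
  rw [← ENNReal.tsum_mul_left]
  calc _ ≤ ∑' m, liminf (fun n => t n m) atTop := ENNReal.tsum_le_tsum hlim
    _ = ∫⁻ m, liminf (fun n => t n m) atTop ∂Measure.count := (lintegral_count _).symm
    _ ≤ liminf (fun n => ∫⁻ m, t n m ∂Measure.count) atTop :=
        lintegral_liminf_le fun n => measurable_of_countable _
    _ ≤ _ := by
        simp_rw [lintegral_count]
        exact liminf_le_liminf hsum

end Limit

/-! ### The homogeneous process in a window -/

section Homogeneous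

variable {d : ℕ}

local notation "𝔼" => EuclideanSpace ℝ (Fin d)

theorem measurableSet_unitCube (z : Fin d → ℤ) : MeasurableSet (unitCube z) := by
  simp only [unitCube, Set.ofPred_forall]
  refine MeasurableSet.iInter fun i => ?_
  have : Measurable fun x : 𝔼 => x i := by fun_prop
  exact (measurableSet_le measurable_const this).inter (measurableSet_lt this measurable_const)

theorem pairwise_disjoint_unitCube : Pairwise fun z z' : Fin d → ℤ =>
    Disjoint (unitCube z) (unitCube z') := by
  intro z z' hne
  rw [Set.disjoint_left]
  intro x hx hx'
  refine hne (funext fun i => ?_)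
  rw [← Int.floor_eq_iff.2 (hx i), ← Int.floor_eq_iff.2 (hx' i)]

theorem ae_pointSet_subset_unitCube :
    ∀ᵐ ω ∂homogeneousLaw d, ∀ z, pointSet (ω z) ⊆ unitCube z ∧ ∀ i, (ω z).2 i ∈ unitCube z := by
  rw [ae_all_iff]
  intro z
  have h1 : ∀ᵐ x ∂cubeMeasure z, x ∈ unitCube z := ae_restrict_mem (measurableSet_unitCube z)
  have h2 : ∀ᵐ X ∂Measure.infinitePi fun _ : ℕ => cubeMeasure z, ∀ i, X i ∈ unitCube z := by
    rw [ae_all_iff]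
    exact fun i => (measurePreserving_eval_infinitePi (fun _ : ℕ => cubeMeasure z)
      i).quasiMeasurePreserving.ae h1
  have h3 : ∀ᵐ p ∂poissonLaw 1 (cubeMeasure z), ∀ i, p.2 i ∈ unitCube z :=
    Measure.quasiMeasurePreserving_snd.ae h2
  have h4 := (measurePreserving_eval_infinitePi (fun z : Fin d → ℤ => poissonLaw 1 (cubeMeasure z))
      z).quasiMeasurePreserving.ae h3
  filter_upwards [h4] with ω hω
  refine ⟨?_, hω⟩
  rintro _ ⟨i, -, rfl⟩
  exact hω i

theorem enumerated_homogeneousSet :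
    Enumerated fun ω : (Fin d → ℤ) → ℕ × (ℕ → 𝔼) => homogeneousSet ω :=
  Enumerated.iUnion fun z => enumerated_pointSet.comp (measurable_pi_apply z)

theorem addPoint_restrict_biUnion (F : Finset (Fin d → ℤ)) :
    addPoint ((volume : Measure 𝔼).restrict (⋃ z ∈ F, unitCube z)) =
      ∑ z ∈ F, addPoint (cubeMeasure z) := by
  ext G S
  rw [LinearMap.sum_apply, AddSubmonoidClass.coe_finsetSum, Finset.sum_apply, addPoint_apply,
    lintegral_biUnion_finset (fun z _ z' _ h => pairwise_disjoint_unitCube h)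
      fun z _ => measurableSet_unitCube z]
  rfl

theorem volume_biUnion_unitCube (F : Finset (Fin d → ℤ)) :
    volume (⋃ z ∈ F, unitCube z : Set 𝔼) = F.card := by
  rw [measure_biUnion_finset (fun z _ z' _ h => pairwise_disjoint_unitCube h)
    fun z _ => measurableSet_unitCube z]
  have : ∀ z : Fin d → ℤ, volume (unitCube z : Set 𝔼) = 1 := fun z => by
    have := measure_univ (μ := cubeMeasure z)
    rwa [cubeMeasure, Measure.restrict_apply_univ] at this
  simp [this]

theorem lintegral_homogeneousSet_inter (F : Finset (Fin d → ℤ)) (G : measurableFunctionals 𝔼) :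
    ∫⁻ ω, G.1 ⟨homogeneousSet ω ∩ ⋃ z ∈ F, unitCube z,
        (enumerated_homogeneousSet.countable ω).mono Set.inter_subset_left⟩ ∂homogeneousLaw d =
      ENNReal.ofReal (Real.exp (-(volume.restrict (⋃ z ∈ F, unitCube z : Set 𝔼)).real Set.univ)) *
        ∑' m : ℕ, (m ! : ℝ≥0∞)⁻¹ *
          ((addPoint ((volume : Measure 𝔼).restrict (⋃ z ∈ F, unitCube z)) ^ m) G).1
            ⟨∅, Set.countable_empty⟩ := by
  classical
  have hcount : ∀ ω : (Fin d → ℤ) → ℕ × (ℕ → 𝔼), (⋃ z ∈ F, pointSet (ω z)).Countable := fun ω =>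
    F.countable_toSet.biUnion fun z _ => enumerated_pointSet.countable (ω z)
  let g : ((Fin d → ℤ) → ℕ × (ℕ → 𝔼)) → ℝ≥0∞ := fun ω =>
    G.1 ⟨∅ ∪ ⋃ z ∈ F, pointSet (ω z), Set.countable_empty.union (hcount ω)⟩
  have hgm : Measurable g := by
    refine G.2 _ (fun ω => ⟨_, _⟩) ((enumerated_const Set.countable_empty).union ?_)
    have := Enumerated.iUnion (κ := F)
      (S := fun z (ω : (Fin d → ℤ) → ℕ × (ℕ → 𝔼)) => pointSet (ω z))
      fun z => enumerated_pointSet.comp (measurable_pi_apply z.1)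
    convert this using 2 with ω
    ext y
    simp
  have h1 : ∫⁻ ω, G.1 ⟨homogeneousSet ω ∩ ⋃ z ∈ F, unitCube z,
        (enumerated_homogeneousSet.countable ω).mono Set.inter_subset_left⟩ ∂homogeneousLaw d =
      ∫⁻ ω, g ω ∂homogeneousLaw d := by
    refine lintegral_congr_ae ?_
    filter_upwards [ae_pointSet_subset_unitCube] with ω hω
    refine congrArg G.1 (Subtype.ext ?_)
    dsimp only
    rw [Set.empty_union]
    ext y
    simp only [homogeneousSet, Set.mem_inter_iff, Set.mem_iUnion, exists_prop]
    constructor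
    · rintro ⟨⟨z, hz⟩, z', hz', hy⟩
      have : z = z' := by
        by_contra hne
        exact Set.disjoint_left.1 (pairwise_disjoint_unitCube hne) ((hω z).1 hz) hy
      exact ⟨z, this ▸ hz', hz⟩
    · rintro ⟨z, hz, hy⟩
      exact ⟨⟨z, hy⟩, z, hz, (hω z).1 hy⟩
  -- Any base point will do: `g` depends only on the coordinates in `F`.
  let x₀ : (Fin d → ℤ) → ℕ × (ℕ → 𝔼) := fun _ => (0, fun _ => 0)
  have h2 : ∫⁻ ω, g ω ∂homogeneousLaw d =
      lmarginal (fun z => poissonLaw 1 (cubeMeasure z)) F g x₀ := by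
    have hgm' : Measurable fun y : F → ℕ × (ℕ → 𝔼) => g (Function.updateFinset x₀ F y) :=
      hgm.comp measurable_updateFinset
    rw [lmarginal, ← Measure.infinitePi_map_restrict (I := F)
      (μ := fun z : Fin d → ℤ => poissonLaw 1 (cubeMeasure z)),
      lintegral_map hgm' (Finset.measurable_restrict F)]
    refine lintegral_congr fun ω => congrArg G.1 (Subtype.ext ?_)
    dsimp only
    congr 1
    refine Set.iUnion₂_congr fun z hz => ?_
    simp [Function.updateFinset, hz]
  rw [h1, h2, lmarginal_poissonLaw (fun z => cubeMeasure z) F G ⟨∅, Set.countable_empty⟩ x₀,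
    addPoint_restrict_biUnion, measureReal_restrict_apply_univ, Measure.real,
    volume_biUnion_unitCube, ← ENNReal.ofReal_pow (Real.exp_pos _).le, ← Real.exp_nat_mul]
  simp

end Homogeneous

section Euclidean

variable {d : ℕ}

local notation "𝔼" => EuclideanSpace ℝ (Fin d)

/-! ### The homogeneous process fills the cones -/

theorem norm_le_sqrt_of_abs_le_one {x : 𝔼} (hx : ∀ i, |x i| ≤ 1) : ‖x‖ ≤ √d := by
  rw [EuclideanSpace.norm_eq]
  refine Real.sqrt_le_sqrt ((Finset.sum_le_card_nsmul _ _ 1 fun i _ => ?_).trans (by simp))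
  rw [Real.norm_eq_abs]
  exact pow_le_one₀ (abs_nonneg _) (hx i)

theorem norm_sub_le_of_mem_unitCube {z : Fin d → ℤ} {x : 𝔼} (hx : x ∈ unitCube z) :
    ‖x - WithLp.toLp 2 (fun i => (z i : ℝ))‖ ≤ √d := by
  refine norm_le_sqrt_of_abs_le_one fun i => ?_
  have := hx i
  rw [PiLp.sub_apply, abs_le]
  constructor <;> simp <;> linarith

theorem floor_mem_unitCube (x : 𝔼) : x ∈ unitCube fun i => ⌊x i⌋ :=
  fun _ => ⟨Int.floor_le _, Int.lt_floor_add_one _⟩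

/-- Comparing `u / t` with `c`, and then `‖u‖⁻¹ • u` with `u / t`, costs at most `r / t < 1 / 4`
each. -/
theorem mem_cone_of_norm_sub_le {c u : 𝔼} (hc : ‖c‖ = 1) {t r : ℝ} (hr : 0 ≤ r) (ht : 4 * r < t)
    (h : ‖u - t • c‖ ≤ r) : u ∈ cone c := by
  have ht0 : 0 < t := by linarith
  have htc : ‖t • c‖ = t := by rw [norm_smul, hc, mul_one, Real.norm_of_nonneg ht0.le]
  have h1 : |‖u‖ - t| ≤ r := by
    have := abs_norm_sub_norm_le u (t • c)
    rw [htc] at this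
    exact this.trans h
  have hu0 : 0 < ‖u‖ := by linarith [(abs_le.1 h1).1]
  refine ⟨norm_pos_iff.1 hu0, ?_⟩
  have e : ‖u‖⁻¹ • u - c = t⁻¹ • (u - t • c) + (‖u‖⁻¹ - t⁻¹) • u := by
    rw [smul_sub, smul_smul, inv_mul_cancel₀ ht0.ne', sub_smul]
    module
  have h2 : ‖t⁻¹ • (u - t • c)‖ ≤ r / t := by
    rw [norm_smul, norm_inv, Real.norm_of_nonneg ht0.le, inv_mul_eq_div]
    gcongr
  have h3 : ‖(‖u‖⁻¹ - t⁻¹) • u‖ ≤ r / t := by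
    have : (‖u‖⁻¹ - t⁻¹) = (t - ‖u‖) / (t * ‖u‖) := by field_simp
    rw [norm_smul, this, norm_div, norm_mul, norm_norm, Real.norm_of_nonneg ht0.le,
      Real.norm_eq_abs, abs_sub_comm, ← div_div, div_mul_cancel₀ _ hu0.ne']
    gcongr
  rw [e]
  refine (norm_add_le _ _).trans_lt ?_
  have : r / t < 1 / 4 := by
    rw [div_lt_iff₀ ht0]
    linarith
  linarith

theorem infinite_unitCube_subset_cone {c : 𝔼} (hc : ‖c‖ = 1) :
    {z : Fin d → ℤ | unitCube z ⊆ cone c}.Infinite := by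
  intro hfin
  obtain ⟨b, hb⟩ := (hfin.image fun z => ‖(WithLp.toLp 2 (fun i => (z i : ℝ)) : 𝔼)‖).bddAbove
  have hs : 0 ≤ √(d : ℝ) := Real.sqrt_nonneg _
  -- The cube around `t • c` lies within `2 * √d` of it, hence `t > 4 * (2 * √d)` for
  -- `mem_cone_of_norm_sub_le`. Its corner has norm at least `t - √d > b`, contradicting the bound
  -- `b`.
  set t : ℝ := 8 * √d + |b| + 1 with ht
  have hz := norm_sub_le_of_mem_unitCube (floor_mem_unitCube (t • c))
  set z : Fin d → ℤ := fun i => ⌊(t • c) i⌋ with hzd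
  have hmem : unitCube z ⊆ cone c := by
    intro u hu
    refine mem_cone_of_norm_sub_le hc (r := 2 * √d) (by positivity) (t := t)
      (by linarith [abs_nonneg b]) ?_
    have h1 := norm_sub_le_of_mem_unitCube hu
    have h2 := norm_sub_le_norm_sub_add_norm_sub u (WithLp.toLp 2 (fun i => (z i : ℝ))) (t • c)
    rw [norm_sub_rev (WithLp.toLp 2 fun i => (z i : ℝ)) (t • c)] at h2
    change ‖t • c - WithLp.toLp 2 (fun i => (z i : ℝ))‖ ≤ _ at hz
    linarith
  have h3 := hb ⟨z, hmem, rfl⟩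
  have h4 : ‖t • c‖ = t := by
    rw [norm_smul, hc, mul_one, Real.norm_of_nonneg (by positivity)]
  have h5 := norm_sub_norm_le (t • c) (WithLp.toLp 2 (fun i => (z i : ℝ)))
  dsimp only at h3
  linarith [le_abs_self b]

/-- The cone contains infinitely many unit cubes, which are occupied independently with the same
positive probability `q`. The second Borel–Cantelli lemma gives infinitely many occupied cubes, and
disjoint cubes provide distinct points. -/
theorem ae_infinite_inter_cone {c : 𝔼} (hc : ‖c‖ = 1) :
    ∀ᵐ ω ∂homogeneousLaw d, (homogeneousSet ω ∩ cone c).Infinite := by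
  classical
  have := (infinite_unitCube_subset_cone hc).to_subtype
  let e : ℕ ↪ {z : Fin d → ℤ | unitCube z ⊆ cone c} := Infinite.natEmbedding _
  let e' : ℕ ↪ (Fin d → ℤ) := e.trans (Function.Embedding.subtype _)
  let s : ℕ → Set ((Fin d → ℤ) → ℕ × (ℕ → 𝔼)) := fun j => {ω | 0 < (ω (e' j)).1}
  have hpos : MeasurableSet {p : ℕ × (ℕ → 𝔼) | 0 < p.1} :=
    measurableSet_lt measurable_const measurable_fst
  have hsm : ∀ j, MeasurableSet (s j) := fun j =>
    (measurable_pi_apply (X := fun _ : Fin d → ℤ => ℕ × (ℕ → 𝔼)) (e' j)) hpos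
  let q : ℝ≥0∞ := poissonMeasure 1 {i | 0 < i}
  have hq0 : q ≠ 0 := by
    refine ne_of_gt (lt_of_lt_of_le ?_ (measure_mono (Set.singleton_subset_iff.2
      (show (1 : ℕ) ∈ {i : ℕ | 0 < i} from Nat.one_pos))))
    rw [poissonMeasure_singleton]
    exact ENNReal.ofReal_pos.2 (by positivity)
  have hq : ∀ z : Fin d → ℤ, poissonLaw 1 (cubeMeasure z) {p | 0 < p.1} = q := by
    intro z
    have : {p : ℕ × (ℕ → 𝔼) | 0 < p.1} = {i | 0 < i} ×ˢ Set.univ := by ext; simp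
    rw [poissonLaw, this, Measure.prod_prod, measure_univ, mul_one]
  have hprod : ∀ S : Finset ℕ, homogeneousLaw d (⋂ j ∈ S, s j) = ∏ j ∈ S, q := by
    intro S
    have : (⋂ j ∈ S, s j) = Set.pi (S.map e') fun _ => {p | 0 < p.1} := by
      ext ω
      simp [s]
    rw [this, homogeneousLaw, Measure.infinitePi_pi _ fun _ _ => hpos, Finset.prod_map]
    exact Finset.prod_congr rfl fun j _ => hq _
  have hone : ∀ j, homogeneousLaw d (s j) = q := fun j => by simpa using hprod {j}
  have hind : iIndepSet s (homogeneousLaw d) := by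
    rw [iIndepSet_iff_meas_biInter hsm]
    intro S
    rw [hprod]
    exact Finset.prod_congr rfl fun j _ => (hone j).symm
  have : IsProbabilityMeasure (homogeneousLaw d) := hind.isProbabilityMeasure
  have hlim := measure_limsup_eq_one hsm hind (by
    simp_rw [hone]
    exact ENNReal.tsum_const_eq_top_of_ne_zero hq0)
  have hae : ∀ᵐ ω ∂homogeneousLaw d, ω ∈ limsup s atTop :=
    (prob_compl_eq_zero_iff (MeasurableSet.measurableSet_limsup hsm)).2 hlim
  filter_upwards [hae, ae_pointSet_subset_unitCube] with ω hω hcube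
  rw [mem_limsup_iff_frequently_mem, Nat.frequently_atTop_iff_infinite] at hω
  have hinj : Set.InjOn (fun j => (ω (e' j)).2 0) {j | ω ∈ s j} := by
    intro i _ j _ hij
    by_contra hne
    have := pairwise_disjoint_unitCube (fun h => hne (e'.injective h) : e' i ≠ e' j)
    refine Set.disjoint_left.1 this ((hcube _).2 0) ?_
    have h2 := (hcube (e' j)).2 0
    dsimp only at hij
    rwa [← hij] at h2
  refine (hω.image hinj).mono ?_
  rintro _ ⟨j, hj, rfl⟩
  have hmem : (ω (e' j)).2 0 ∈ pointSet (ω (e' j)) := ⟨0, hj, rfl⟩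
  exact ⟨Set.mem_iUnion.2 ⟨_, hmem⟩, (e j).2 ((hcube _).2 0)⟩

instance : IsProbabilityMeasure (homogeneousLaw d) := by
  unfold homogeneousLaw
  infer_instance

theorem ae_exists_filled (k : ℕ) {T : Finset 𝔼} (hT : ∀ c ∈ T, ‖c‖ = 1) :
    ∀ᵐ ω ∂homogeneousLaw d, ∃ r : ℕ, Filled k T r (homogeneousSet ω) := by
  have h : ∀ᵐ ω ∂homogeneousLaw d, ∀ c ∈ T, (homogeneousSet ω ∩ cone c).Infinite :=
    (ae_ball_iff T.countable_toSet).2 fun c hc => ae_infinite_inter_cone (hT c hc)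
  filter_upwards [h] with ω hω
  have : ∀ c ∈ T, ∃ r : ℕ, (k : ℕ∞) ≤
      (homogeneousSet ω ∩ (cone c ∩ Metric.closedBall 0 (r : ℝ))).encard := by
    intro c hc
    obtain ⟨t, hts, htc⟩ := Set.exists_subset_encard_eq (k := (k : ℕ∞))
      ((hω c hc).encard_eq ▸ le_top)
    have hfin : t.Finite := Set.finite_of_encard_eq_coe htc
    obtain ⟨b, hb⟩ := (hfin.image fun x => ‖x‖).bddAbove
    obtain ⟨r, hr⟩ := exists_nat_ge b
    refine ⟨r, htc ▸ Set.encard_le_encard fun x hx => ⟨(hts hx).1, (hts hx).2, ?_⟩⟩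
    exact mem_closedBall_zero_iff.2 ((hb ⟨x, hx, rfl⟩).trans hr)
  choose! r hr using this
  refine ⟨T.sup r, fun c hc => (hr c hc).trans (Set.encard_le_encard ?_)⟩
  refine Set.inter_subset_inter_right _ (Set.inter_subset_inter_right _
    (Metric.closedBall_subset_closedBall ?_))
  exact_mod_cast Finset.le_sup (f := r) hc

/-! ### Zooming in at a Lebesgue point of the density -/

/-- The homothety that maps `x` to the origin and magnifies by the factor `s⁻¹`. -/
def zoom (x : 𝔼) (s : ℝ) (y : 𝔼) : 𝔼 := s⁻¹ • (y - x)

theorem measurable_zoom (x : 𝔼) (s : ℝ) : Measurable (zoom x s) := by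
  unfold zoom
  fun_prop

theorem degree_zoom (k : ℕ) (x : 𝔼) {s : ℝ} (hs : 0 < s) (S : Set 𝔼) :
    degree k (insert 0 (zoom x s '' S)) 0 = degree k (insert x S) x := by
  let ψ : 𝔼 ≃ 𝔼 :=
    { toFun := zoom x s
      invFun := fun u => s • u + x
      left_inv := fun y => by simp [zoom, hs.ne']
      right_inv := fun u => by simp [zoom, hs.ne'] }
  have h0 : ψ x = 0 := by simp [ψ, zoom]
  have h1 : insert 0 (zoom x s '' S) = ψ '' insert x S := by
    rw [Set.image_insert_eq, h0]
    rfl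
  rw [h1, ← h0]
  refine degree_image (s := s⁻¹) (by positivity) ψ fun a b => ?_
  change ‖zoom x s a - zoom x s b‖ = _
  rw [zoom, zoom, ← smul_sub, sub_sub_sub_cancel_right, norm_smul, dist_eq_norm,
    Real.norm_of_nonneg (by positivity)]

theorem lintegral_zoom (x : 𝔼) {s : ℝ} (hs : 0 < s) {h : 𝔼 → ℝ≥0∞} (hh : Measurable h) :
    ∫⁻ y, h (zoom x s y) = ENNReal.ofReal (s ^ d) * ∫⁻ u, h u := by
  have h1 : Measurable fun y : 𝔼 => h (s⁻¹ • y) := hh.comp (measurable_const_smul _)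
  have h2 := lintegral_sub_right_eq_self (μ := (volume : Measure 𝔼)) (fun y => h (s⁻¹ • y)) x
  unfold zoom
  rw [h2, ← lintegral_map hh (measurable_const_smul s⁻¹),
    Measure.map_addHaar_smul _ (inv_ne_zero hs.ne'), lintegral_smul_measure, finrank_euclideanSpace,
    Fintype.card_fin, inv_pow, inv_inv, abs_of_pos (by positivity), smul_eq_mul]

/-- Comparison of the density `f` near `x`, magnified to unit intensity, with Lebesgue measure. -/
theorem zoom_estimates {f : 𝔼 → ℝ} (hf : IsProbDensity f) {x : 𝔼} {a s R : ℝ} (ha : 0 ≤ a)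
    (hfx : 0 ≤ f x) (hs : 0 < s)
    (hasf : a * f x * s ^ d = 1) {W : Set 𝔼} (hW : MeasurableSet W)
    (hWR : W ⊆ Metric.closedBall 0 R) {h : 𝔼 → ℝ≥0∞} (hh : Measurable h) {B : ℝ≥0∞}
    (hB : ∀ u, h u ≤ B) :
    ∫⁻ u in W, h u ≤ ENNReal.ofReal a * ∫⁻ u in W, h u ∂((densityMeasure f).map (zoom x s)) +
        B * (ENNReal.ofReal a * ∫⁻ y in Metric.closedBall x (R * s), ENNReal.ofReal ‖f y - f x‖) ∧
      ENNReal.ofReal a * ∫⁻ u in W, h u ∂((densityMeasure f).map (zoom x s)) ≤ (∫⁻ u in W, h u) +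
        B * (ENNReal.ofReal a * ∫⁻ y in Metric.closedBall x (R * s), ENNReal.ofReal ‖f y - f x‖) := by
  set g : 𝔼 → ℝ≥0∞ := W.indicator h with hg
  have hgm : Measurable g := hh.indicator hW
  have hzm := measurable_zoom x s
  have hgz : Measurable fun y => g (zoom x s y) := hgm.comp hzm
  set D : 𝔼 → ℝ≥0∞ := (Metric.closedBall x (R * s)).indicator fun y => ENNReal.ofReal ‖f y - f x‖
    with hD
  have hfm : AEMeasurable f := hf.integrable.aemeasurable
  have hDm : AEMeasurable D := by
    refine AEMeasurable.indicator ?_ Metric.isClosed_closedBall.measurableSet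
    exact (hfm.sub_const _).norm.ennreal_ofReal
  have hDi : ∫⁻ y, D y = ∫⁻ y in Metric.closedBall x (R * s), ENNReal.ofReal ‖f y - f x‖ :=
    lintegral_indicator Metric.isClosed_closedBall.measurableSet _
  -- The normalization `a * f x * s ^ d = 1` makes Lebesgue measure the image of `a * f x` times
  -- Lebesgue measure. Thus the two integrals differ only in having `f x` or `f y` as density, and
  -- `D` dominates the discrepancy.
  have e1 : ∫⁻ u in W, h u = ENNReal.ofReal a * ∫⁻ y, ENNReal.ofReal (f x) * g (zoom x s y) := by
    rw [lintegral_const_mul _ hgz, lintegral_zoom x hs hgm, ← mul_assoc, ← mul_assoc,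
      ← ENNReal.ofReal_mul ha, ← ENNReal.ofReal_mul (by positivity), hasf, ENNReal.ofReal_one,
      one_mul, hg, lintegral_indicator hW]
  have e2 : ∫⁻ u in W, h u ∂((densityMeasure f).map (zoom x s)) =
      ∫⁻ y, ENNReal.ofReal (f y) * g (zoom x s y) := by
    rw [← lintegral_indicator hW, lintegral_map hgm hzm, densityMeasure,
      lintegral_withDensity_eq_lintegral_mul₀ hfm.ennreal_ofReal hgz.aemeasurable]
    rfl
  have hgB : ∀ y, g (zoom x s y) ≤ B := fun y =>
    (Set.indicator_le_self _ _ _).trans (hB _)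
  have hball : ∀ y, y ∉ Metric.closedBall x (R * s) → g (zoom x s y) = 0 := by
    intro y hy
    refine Set.indicator_of_notMem (fun hyW => hy ?_) _
    have := hWR hyW
    rw [mem_closedBall_zero_iff, zoom, norm_smul, norm_inv, Real.norm_of_nonneg hs.le,
      inv_mul_le_iff₀ hs] at this
    rwa [mem_closedBall_iff_norm, mul_comm]
  have key : ∀ y, ENNReal.ofReal (f x) * g (zoom x s y) ≤
      ENNReal.ofReal (f y) * g (zoom x s y) + B * D y ∧
      ENNReal.ofReal (f y) * g (zoom x s y) ≤
      ENNReal.ofReal (f x) * g (zoom x s y) + B * D y := by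
    intro y
    by_cases hy : y ∈ Metric.closedBall x (R * s)
    · have hDy : D y = ENNReal.ofReal ‖f y - f x‖ := Set.indicator_of_mem hy _
      have a1 : ENNReal.ofReal (f x) ≤ ENNReal.ofReal (f y) + D y := by
        rw [hDy]
        refine (ENNReal.ofReal_le_ofReal ?_).trans ENNReal.ofReal_add_le
        rw [Real.norm_eq_abs]
        linarith [neg_abs_le (f y - f x)]
      have a2 : ENNReal.ofReal (f y) ≤ ENNReal.ofReal (f x) + D y := by
        rw [hDy]
        refine (ENNReal.ofReal_le_ofReal ?_).trans ENNReal.ofReal_add_le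
        rw [Real.norm_eq_abs]
        linarith [le_abs_self (f y - f x)]
      constructor
      · calc _ ≤ (ENNReal.ofReal (f y) + D y) * g (zoom x s y) := by gcongr
          _ = ENNReal.ofReal (f y) * g (zoom x s y) + g (zoom x s y) * D y := by ring
          _ ≤ _ := by gcongr; exact hgB y
      · calc _ ≤ (ENNReal.ofReal (f x) + D y) * g (zoom x s y) := by gcongr
          _ = ENNReal.ofReal (f x) * g (zoom x s y) + g (zoom x s y) * D y := by ring
          _ ≤ _ := by gcongr; exact hgB y
    · simp [hball y hy]
  have hfgm : AEMeasurable fun y => ENNReal.ofReal (f y) * g (zoom x s y) :=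
    hfm.ennreal_ofReal.mul hgz.aemeasurable
  rw [e1, e2, ← hDi, mul_left_comm, ← mul_add, ← mul_add, ← lintegral_const_mul'' _ hDm,
    ← lintegral_add_left (hgz.const_mul _),
    ← lintegral_add_left' hfgm]
  exact ⟨mul_le_mul_right (lintegral_mono fun y => (key y).1) _,
    mul_le_mul_right (lintegral_mono fun y => (key y).2) _⟩

/-- The scale on which a density with value `v` at a point has about one out of `n` points. -/
def scale (d : ℕ) (v : ℝ) (n : ℕ) : ℝ := ((n * v)⁻¹) ^ (1 / d : ℝ)

theorem scale_pos {v : ℝ} (hv : 0 < v) {n : ℕ} (hn : 1 ≤ n) : 0 < scale d v n := by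
  have : (0 : ℝ) < n := by exact_mod_cast hn
  unfold scale
  positivity

theorem scale_pow (hd : 1 ≤ d) {v : ℝ} (hv : 0 < v) {n : ℕ} (hn : 1 ≤ n) :
    n * v * scale d v n ^ d = 1 := by
  have : (0 : ℝ) < n := by exact_mod_cast hn
  rw [scale, one_div, Real.rpow_inv_natCast_pow (by positivity) (by omega)]
  exact mul_inv_cancel₀ (by positivity)

theorem tendsto_scale (hd : 1 ≤ d) {v : ℝ} (hv : 0 < v) {R : ℝ} (hR : 0 < R) :
    Tendsto (fun n => R * scale d v n) atTop (𝓝[>] 0) := by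
  refine tendsto_nhdsWithin_iff.2 ⟨?_, ?_⟩
  · have h1 : Tendsto (fun n : ℕ => ((n : ℝ) * v)⁻¹) atTop (𝓝 0) :=
      (tendsto_natCast_atTop_atTop.atTop_mul_const hv).inv_tendsto_atTop
    have hd' : (0 : ℝ) < 1 / d := by
      have : (0 : ℝ) < d := by exact_mod_cast hd
      positivity
    have h2 := h1.rpow_const (p := 1 / d) (Or.inr hd'.le)
    rw [Real.zero_rpow hd'.ne'] at h2
    simpa only [scale, mul_zero] using h2.const_mul R
  · filter_upwards [eventually_ge_atTop 1] with n hn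
    exact mul_pos hR (scale_pos hv hn)

/-- `x` is a Lebesgue point of `f`. -/
def IsLebesguePoint (f : 𝔼 → ℝ) (x : 𝔼) : Prop :=
  ∀ δ : ℕ → ℝ, Tendsto δ atTop (𝓝[>] 0) →
    Tendsto (fun n => ⨍ y in Metric.closedBall x (δ n), ‖f y - f x‖) atTop (𝓝 0)

theorem IsProbDensity.ae_isLebesguePoint {f : 𝔼 → ℝ} (hf : IsProbDensity f) :
    ∀ᵐ x, IsLebesguePoint f x := by
  filter_upwards [IsUnifLocDoublingMeasure.ae_tendsto_average_norm_sub volume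
    hf.integrable.locallyIntegrable 1] with x hx δ hδ
  refine hx (fun _ => x) δ hδ ?_
  filter_upwards [hδ.eventually self_mem_nhdsWithin] with n hn
  exact Metric.mem_closedBall_self (by simpa using le_of_lt hn)

/-- Since `n * f x * scale d (f x) n ^ d = 1`, the factor `n` is a constant divided by the volume of
the ball, so the expression is a constant times the average in the definition of a Lebesgue point.
-/
theorem IsLebesguePoint.tendsto_lintegral (hd : 1 ≤ d) {f : 𝔼 → ℝ} (hf : IsProbDensity f) {x : 𝔼}
    (hx : IsLebesguePoint f x) (hfx : 0 < f x) {R : ℝ} (hR : 0 < R) :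
    Tendsto (fun n : ℕ => ENNReal.ofReal n *
      ∫⁻ y in Metric.closedBall x (R * scale d (f x) n), ENNReal.ofReal ‖f y - f x‖)
      atTop (𝓝 0) := by
  have h1 := hx _ (tendsto_scale hd hfx hR)
  have h2 := ENNReal.tendsto_ofReal
    (h1.const_mul (R ^ d * (volume : Measure 𝔼).real (Metric.ball 0 1) / f x))
  rw [mul_zero, ENNReal.ofReal_zero] at h2
  refine h2.congr' ?_
  filter_upwards [eventually_ge_atTop 1] with n hn
  have hs := scale_pos (d := d) hfx hn
  have hsd := scale_pow hd hfx hn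
  set s := scale d (f x) n
  have hint : IntegrableOn (fun y => ‖f y - f x‖) (Metric.closedBall x (R * s)) :=
    (hf.integrable.integrableOn.sub (integrableOn_const (by
      exact (measure_closedBall_lt_top).ne))).norm
  rw [← ofReal_integral_eq_lintegral_ofReal hint (ae_of_all _ fun y => norm_nonneg _),
    ← ENNReal.ofReal_mul (by positivity), setAverage_eq, smul_eq_mul,
    Measure.addHaar_real_closedBall _ _ (by positivity), finrank_euclideanSpace, Fintype.card_fin]
  congr 1
  have hv : (volume : Measure 𝔼).real (Metric.ball 0 1) ≠ 0 :=
    (ENNReal.toReal_pos (Metric.measure_ball_pos _ _ one_pos).ne' measure_ball_lt_top.ne).ne'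
  rw [mul_pow, mul_inv, mul_inv]
  have hn' : (n : ℝ) = (f x * s ^ d)⁻¹ := by
    exact eq_inv_of_mul_eq_one_left (by rw [← mul_assoc]; exact hsd)
  rw [hn']
  field_simp

theorem homogeneous_le_liminf_zoom (hd : 1 ≤ d) {f : 𝔼 → ℝ} (hf : IsProbDensity f) {x : 𝔼}
    (hx : IsLebesguePoint f x) (hfx : 0 < f x) (F : Finset (Fin d → ℤ))
    (G : measurableFunctionals 𝔼) (hG : ∀ S, G.1 S ≤ 1) :
    ∫⁻ ω, G.1 ⟨homogeneousSet ω ∩ ⋃ z ∈ F, unitCube z,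
        (enumerated_homogeneousSet.countable ω).mono Set.inter_subset_left⟩ ∂homogeneousLaw d ≤
      liminf (fun n : ℕ => ∫⁻ y, G.1 ⟨zoom x (scale d (f x) n) '' Set.range y ∩
        ⋃ z ∈ F, unitCube z, ((Set.countable_range y).image _).mono Set.inter_subset_left⟩
          ∂(Measure.pi fun _ : Fin n => densityMeasure f)) atTop := by
  have := hf.isProbabilityMeasure
  set W : Set 𝔼 := ⋃ z ∈ F, unitCube z with hWd
  have hW : MeasurableSet W := F.measurableSet_biUnion fun z _ => measurableSet_unitCube z
  obtain ⟨R, hR, hWR⟩ : ∃ R : ℝ, 0 < R ∧ W ⊆ Metric.closedBall 0 R := by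
    have : Bornology.IsBounded W := by
      rw [hWd, Bornology.isBounded_biUnion_finset]
      intro z _
      refine (Metric.isBounded_closedBall
        (x := (WithLp.toLp 2 (fun i => (z i : ℝ)) : 𝔼)) (r := √d)).subset fun u hu => ?_
      rw [mem_closedBall_iff_norm]
      exact norm_sub_le_of_mem_unitCube hu
    obtain ⟨R, hR⟩ := this.subset_closedBall 0
    exact ⟨max R 1, by positivity,
      hR.trans (Metric.closedBall_subset_closedBall (le_max_left _ _))⟩
  have hprob : ∀ n, IsProbabilityMeasure ((densityMeasure f).map (zoom x (scale d (f x) n))) :=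
    fun n => Measure.isProbabilityMeasure_map (measurable_zoom _ _).aemeasurable
  set ε : ℕ → ℝ≥0∞ := fun n => ENNReal.ofReal n *
      ∫⁻ y in Metric.closedBall x (R * scale d (f x) n), ENNReal.ofReal ‖f y - f x‖ with hεd
  have hε : Tendsto ε atTop (𝓝 0) := hx.tendsto_lintegral hd hf hfx hR
  have hest : ∀ n : ℕ, 1 ≤ n → ∀ h : 𝔼 → ℝ≥0∞, Measurable h → ∀ B : ℝ≥0∞, (∀ u, h u ≤ B) →
      ∫⁻ u in W, h u ≤ n * ∫⁻ u in W, h u ∂((densityMeasure f).map (zoom x (scale d (f x) n))) +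
        B * ε n ∧
      n * ∫⁻ u in W, h u ∂((densityMeasure f).map (zoom x (scale d (f x) n))) ≤
        (∫⁻ u in W, h u) + B * ε n := by
    intro n hn h hh B hB
    have := zoom_estimates hf (a := n) (by positivity) hfx.le (scale_pos (d := d) hfx hn)
      (scale_pow hd hfx hn) hW hWR hh hB
    simpa only [hεd, ENNReal.ofReal_natCast] using this
  have hvol : volume W ≠ ∞ := by
    rw [hWd, volume_biUnion_unitCube]
    simp
  have : IsFiniteMeasure ((volume : Measure 𝔼).restrict W) := ⟨by
    rw [Measure.restrict_apply_univ]
    exact hvol.lt_top⟩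
  -- Convergence of the masses is the two-sided estimate with `h = 1`; everywhere else the lower
  -- estimate suffices.
  have hmass : Tendsto (fun n : ℕ => (n : ℝ) *
      ((densityMeasure f).map (zoom x (scale d (f x) n))).real W) atTop
      (𝓝 (((volume : Measure 𝔼).restrict W).real Set.univ)) := by
    have h1 : Tendsto (fun n : ℕ => (n : ℝ≥0∞) *
        ((densityMeasure f).map (zoom x (scale d (f x) n))) W) atTop (𝓝 (volume W)) := by
      have hup : Tendsto (fun n => volume W + ε n) atTop (𝓝 (volume W)) := by
        simpa using hε.const_add (volume W)
      have hlow : Tendsto (fun n => volume W - ε n) atTop (𝓝 (volume W)) := by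
        simpa using ENNReal.Tendsto.sub tendsto_const_nhds hε (Or.inl hvol)
      refine tendsto_of_tendsto_of_tendsto_of_le_of_le' hlow hup ?_ ?_
      · filter_upwards [eventually_ge_atTop 1] with n hn
        have := (hest n hn (fun _ => 1) measurable_const 1 fun _ => le_rfl).1
        simpa using this
      · filter_upwards [eventually_ge_atTop 1] with n hn
        have := (hest n hn (fun _ => 1) measurable_const 1 fun _ => le_rfl).2
        simpa using this
    have h2 := (ENNReal.tendsto_toReal hvol).comp h1
    simpa [Function.comp_def, ENNReal.toReal_mul, Measure.real] using h2
  rw [lintegral_homogeneousSet_inter]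
  refine (poisson_le_liminf_binomial hW hε hmass ?_ G hG).trans (le_of_eq ?_)
  · filter_upwards [eventually_ge_atTop 1] with n hn h hh B hB
    exact (hest n hn h hh B hB).1
  · congr 1
    ext n
    have hmap := Measure.pi_map_pi (μ := fun _ : Fin n => densityMeasure f)
      (f := fun _ => zoom x (scale d (f x) n)) fun _ => (measurable_zoom _ _).aemeasurable
    rw [← hmap, lintegral_map]
    · refine lintegral_congr fun y => congrArg G.1 (Subtype.ext ?_)
      dsimp only
      rw [← Set.range_comp]
      rfl
    · exact G.2 _ (fun y : Fin n → 𝔼 => ⟨Set.range y ∩ W, _⟩) ((enumerated_range n).inter hW)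
    · exact measurable_pi_lambda _ fun i => (measurable_zoom _ _).comp (measurable_pi_apply i)

theorem Enumerated.measurable_degree {Ω E : Type*} [MeasurableSpace Ω] [MeasurableSpace E]
    [MetricSpace E] [BorelSpace E] [SecondCountableTopology E] {S : Ω → Set E} (hS : Enumerated S)
    (k : ℕ) {a : Ω → E} (ha : Measurable a) : Measurable fun ω => degree k (S ω) (a ω) :=
  ENat.measurable_iff.2 fun ℓ => hS.measurableSet_degree_eq k ℓ ha

/-! ### Convergence of the degree distribution -/

/-- The indicator of the configurations that fill the cones up to distance `r` and in which the
origin has a degree in `A`. -/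
def filledDegreeFunctional (k : ℕ) (T : Finset 𝔼) (r : ℝ) (A : Set ℕ∞) :
    measurableFunctionals 𝔼 :=
  ⟨fun S => Set.indicator {S : Config 𝔼 | Filled k T r S.1 ∧ degree k (insert 0 S.1) 0 ∈ A} 1 S, by
    intro Ω _ S hS
    refine measurable_one.indicator (s := {ω | Filled k T r (S ω).1 ∧
      degree k (insert 0 (S ω).1) 0 ∈ A}) ?_
    exact (hS.measurableSet_filled k T r).inter
      ((hS.insert measurable_const).measurable_degree k measurable_const A.to_countable.measurableSet)⟩

theorem exists_unitCubes_cover (r : ℝ) :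
    ∃ F : Finset (Fin d → ℤ), Metric.closedBall (0 : 𝔼) r ⊆ ⋃ z ∈ F, unitCube z := by
  classical
  refine ⟨Fintype.piFinset fun _ => Finset.Icc ⌊-r⌋ ⌊r⌋, fun x hx => ?_⟩
  refine Set.mem_biUnion (x := fun i => ⌊x i⌋) ?_ (floor_mem_unitCube x)
  simp only [Finset.mem_coe, Fintype.mem_piFinset, Finset.mem_Icc]
  intro i
  have h1 : |x i| ≤ r := by
    have := PiLp.norm_apply_le x i
    rw [Real.norm_eq_abs] at this
    exact this.trans (mem_closedBall_zero_iff.1 hx)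
  exact ⟨Int.floor_le_floor (abs_le.1 h1).1, Int.floor_le_floor (abs_le.1 h1).2⟩

theorem measurableSet_degree_insert_range (k n : ℕ) (A : Set ℕ∞) :
    MeasurableSet {p : 𝔼 × (Fin n → 𝔼) | degree k (insert p.1 (Set.range p.2)) p.1 ∈ A} :=
  (((enumerated_range n).comp measurable_snd).insert measurable_fst).measurable_degree k
    measurable_fst A.to_countable.measurableSet

theorem measurableSet_degree_insert_homogeneousSet (k : ℕ) (A : Set ℕ∞) :
    MeasurableSet {ω | degree k (insert (0 : 𝔼) (homogeneousSet ω)) 0 ∈ A} :=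
  (enumerated_homogeneousSet.insert measurable_const).measurable_degree k measurable_const
    A.to_countable.measurableSet

/-- The event with filled cones is decided inside finitely many unit cubes covering the ball of
radius `2 * r`. On the binomial side the filling condition is dropped and the magnification undone.
-/
theorem measure_filled_le_liminf (hd : 1 ≤ d) (k : ℕ) {T : Finset 𝔼}
    (hT : ∀ u : 𝔼, u ≠ 0 → ∃ c ∈ T, u ∈ cone c) {f : 𝔼 → ℝ} (hf : IsProbDensity f) {x : 𝔼}
    (hx : IsLebesguePoint f x) (hfx : 0 < f x) (A : Set ℕ∞) {r : ℝ} (hr : 0 ≤ r) :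
    homogeneousLaw d {ω | Filled k T r (homogeneousSet ω) ∧
        degree k (insert (0 : 𝔼) (homogeneousSet ω)) 0 ∈ A} ≤
      liminf (fun n : ℕ => (Measure.pi fun _ : Fin n => densityMeasure f)
        {y | degree k (insert x (Set.range y)) x ∈ A}) atTop := by
  obtain ⟨F, hF⟩ := exists_unitCubes_cover (d := d) (2 * r)
  have hF' : Metric.closedBall (0 : 𝔼) r ⊆ ⋃ z ∈ F, unitCube z :=
    (Metric.closedBall_subset_closedBall (by linarith)).trans hF
  set G := filledDegreeFunctional k T r A with hG
  have hind : ∀ S : Set 𝔼, (Filled k T r (S ∩ ⋃ z ∈ F, unitCube z) ∧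
      degree k (insert 0 (S ∩ ⋃ z ∈ F, unitCube z)) 0 ∈ A) ↔
      (Filled k T r S ∧ degree k (insert 0 S) 0 ∈ A) := by
    intro S
    rw [filled_inter_iff hF']
    exact and_congr_right fun h => by rw [h.degree_inter hT hr hF]
  let D : Set (Set 𝔼) := {S | Filled k T r S ∧ degree k (insert 0 S) 0 ∈ A}
  have hval : ∀ (S : Set 𝔼) (h : (S ∩ ⋃ z ∈ F, unitCube z).Countable),
      G.1 ⟨S ∩ ⋃ z ∈ F, unitCube z, h⟩ = D.indicator 1 S := by
    intro S h
    by_cases hS : S ∈ D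
    · have h' : (⟨S ∩ ⋃ z ∈ F, unitCube z, h⟩ : Config 𝔼) ∈
          {S : Config 𝔼 | Filled k T r S.1 ∧ degree k (insert 0 S.1) 0 ∈ A} := (hind S).2 hS
      exact (Set.indicator_of_mem h' (1 : Config 𝔼 → ℝ≥0∞)).trans (Set.indicator_of_mem hS 1).symm
    · have h' : (⟨S ∩ ⋃ z ∈ F, unitCube z, h⟩ : Config 𝔼) ∉
          {S : Config 𝔼 | Filled k T r S.1 ∧ degree k (insert 0 S.1) 0 ∈ A} :=
        fun h => hS ((hind S).1 h)
      exact (Set.indicator_of_notMem h' (1 : Config 𝔼 → ℝ≥0∞)).trans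
        (Set.indicator_of_notMem hS 1).symm
  have h1 := homogeneous_le_liminf_zoom hd hf hx hfx F G
    fun S => Set.indicator_le_self' (fun _ _ => zero_le_one) S
  refine le_trans (le_of_eq ?_) (h1.trans (liminf_le_liminf ?_))
  · rw [← lintegral_indicator_one]
    · exact lintegral_congr fun ω => (hval _ _).symm
    · exact (enumerated_homogeneousSet.measurableSet_filled k T r).inter
        (measurableSet_degree_insert_homogeneousSet k A)
  · filter_upwards [eventually_ge_atTop 1] with n hn
    have hs := scale_pos (d := d) hfx hn
    have hm : MeasurableSet {y : Fin n → 𝔼 | degree k (insert x (Set.range y)) x ∈ A} :=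
      measurable_prodMk_left (measurableSet_degree_insert_range k n A)
    rw [← lintegral_indicator_one hm]
    refine lintegral_mono fun y => ?_
    rw [hval]
    refine Set.indicator_apply_le' (fun h => ?_) (fun _ => zero_le)
    rw [Set.indicator_of_mem]
    · exact le_rfl
    · rw [Set.mem_ofPred_eq, ← degree_zoom k x hs]
      exact h.2

theorem measure_degree_le_liminf (hd : 1 ≤ d) (k : ℕ) {f : 𝔼 → ℝ} (hf : IsProbDensity f) {x : 𝔼}
    (hx : IsLebesguePoint f x) (hfx : 0 < f x) (A : Set ℕ∞) :
    homogeneousLaw d {ω | degree k (insert (0 : 𝔼) (homogeneousSet ω)) 0 ∈ A} ≤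
      liminf (fun n : ℕ => (Measure.pi fun _ : Fin n => densityMeasure f)
        {y | degree k (insert x (Set.range y)) x ∈ A}) atTop := by
  obtain ⟨T, hT1, hT⟩ := exists_cone_cover (E := 𝔼)
  let D : ℕ → Set ((Fin d → ℤ) → ℕ × (ℕ → 𝔼)) := fun r =>
    {ω | Filled k T r (homogeneousSet ω) ∧ degree k (insert (0 : 𝔼) (homogeneousSet ω)) 0 ∈ A}
  have hmono : Monotone D := fun r r' h ω hω =>
    ⟨hω.1.mono (by exact_mod_cast h) subset_rfl, hω.2⟩
  calc _ ≤ homogeneousLaw d (⋃ r, D r) := by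
        refine measure_mono_ae ?_
        filter_upwards [ae_exists_filled k hT1] with ω hω h
        obtain ⟨r, hr⟩ := hω
        exact Set.mem_iUnion.2 ⟨r, hr, h⟩
    _ = ⨆ r, homogeneousLaw d (D r) := hmono.measure_iUnion
    _ ≤ _ := iSup_le fun r => measure_filled_le_liminf hd k hT hf hx hfx A r.cast_nonneg

/-- The lower bound for the complement of `{ℓ}` is an upper bound for `{ℓ}`, because both sides are
probability measures. -/
theorem tendsto_measure_degree (hd : 1 ≤ d) (k ℓ : ℕ) {f : 𝔼 → ℝ} (hf : IsProbDensity f) {x : 𝔼}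
    (hx : IsLebesguePoint f x) (hfx : 0 < f x) :
    Tendsto (fun n : ℕ => (Measure.pi fun _ : Fin n => densityMeasure f)
        {y | degree k (insert x (Set.range y)) x ∈ ({(ℓ : ℕ∞)} : Set ℕ∞)}) atTop
      (𝓝 (homogeneousLaw d
        {ω | degree k (insert (0 : 𝔼) (homogeneousSet ω)) 0 ∈ ({(ℓ : ℕ∞)} : Set ℕ∞)})) := by
  have := hf.isProbabilityMeasure
  refine tendsto_of_le_liminf_of_limsup_le (measure_degree_le_liminf hd k hf hx hfx _) ?_
  have h := measure_degree_le_liminf hd k hf hx hfx {(ℓ : ℕ∞)}ᶜ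
  have e1 := prob_compl_eq_one_sub (μ := homogeneousLaw d)
    (measurableSet_degree_insert_homogeneousSet (d := d) k {(ℓ : ℕ∞)}ᶜ)
  have e2 : ∀ n : ℕ, (Measure.pi fun _ : Fin n => densityMeasure f)
      {y | degree k (insert x (Set.range y)) x ∈ ({(ℓ : ℕ∞)} : Set ℕ∞)} =
      1 - (Measure.pi fun _ : Fin n => densityMeasure f)
        {y | degree k (insert x (Set.range y)) x ∈ ({(ℓ : ℕ∞)} : Set ℕ∞)ᶜ} := fun n => by
    have hm : MeasurableSet
        {y : Fin n → 𝔼 | degree k (insert x (Set.range y)) x ∈ ({(ℓ : ℕ∞)} : Set ℕ∞)ᶜ} :=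
      measurable_prodMk_left (measurableSet_degree_insert_range k n {(ℓ : ℕ∞)}ᶜ)
    rw [← prob_compl_eq_one_sub hm]
    congr 1
    ext y
    simp
  simp_rw [e2]
  rw [ENNReal.limsup_const_sub _ _ ENNReal.one_ne_top]
  have e3 : {ω | degree k (insert (0 : 𝔼) (homogeneousSet ω)) 0 ∈ ({(ℓ : ℕ∞)} : Set ℕ∞)} =
      {ω | degree k (insert (0 : 𝔼) (homogeneousSet ω)) 0 ∈ ({(ℓ : ℕ∞)} : Set ℕ∞)ᶜ}ᶜ := by
    ext ω
    simp
  rw [e3, e1]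
  exact tsub_le_tsub_left h _

theorem IsProbDensity.ae_pos {f : 𝔼 → ℝ} (hf : IsProbDensity f) :
    ∀ᵐ x ∂densityMeasure f, 0 < f x := by
  rw [densityMeasure, ae_withDensity_iff' hf.integrable.aemeasurable.ennreal_ofReal]
  refine ae_of_all _ fun x hx => ?_
  exact ENNReal.ofReal_pos.1 (pos_iff_ne_zero.2 hx)

/-- The probability that a point with density `f` has degree `ℓ` in the graph on this point and `n`
further independent points with density `f`. -/
def degreeProb (k ℓ : ℕ) (f : 𝔼 → ℝ) (n : ℕ) : ℝ :=
  ((densityMeasure f).prod (Measure.pi fun _ : Fin n => densityMeasure f)).real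
    {p | degree k (insert p.1 (Set.range p.2)) p.1 ∈ ({(ℓ : ℕ∞)} : Set ℕ∞)}

theorem tendsto_degreeProb (hd : 1 ≤ d) (k ℓ : ℕ) {f : 𝔼 → ℝ} (hf : IsProbDensity f) :
    Tendsto (degreeProb k ℓ f) atTop (𝓝 (limitProb d k ℓ)) := by
  have := hf.isProbabilityMeasure
  have hleb : ∀ᵐ x ∂densityMeasure f, IsLebesguePoint f x :=
    (withDensity_absolutelyContinuous _ _).ae_le hf.ae_isLebesguePoint
  have h := tendsto_lintegral_of_dominated_convergence (μ := densityMeasure f)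
    (F := fun (n : ℕ) x => (Measure.pi fun _ : Fin n => densityMeasure f)
        {y | degree k (insert x (Set.range y)) x ∈ ({(ℓ : ℕ∞)} : Set ℕ∞)})
    (f := fun _ => homogeneousLaw d
        {ω | degree k (insert (0 : 𝔼) (homogeneousSet ω)) 0 ∈ ({(ℓ : ℕ∞)} : Set ℕ∞)})
    (fun _ => 1)
    (fun n => measurable_measure_prodMk_left (measurableSet_degree_insert_range k n {(ℓ : ℕ∞)}))
    (fun n => ae_of_all _ fun x => prob_le_one) (by simp)
    (by filter_upwards [hleb, hf.ae_pos] with x hx hfx using tendsto_measure_degree hd k ℓ hf hx hfx)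
  rw [lintegral_const, measure_univ, mul_one] at h
  have h2 := (ENNReal.tendsto_toReal (measure_ne_top _ _)).comp h
  refine h2.congr fun n => ?_
  rw [degreeProb, Measure.real, Measure.prod_apply (measurableSet_degree_insert_range k n _)]
  rfl

/-! ### General position -/

/-- The injective tuples without ties between distances. -/
def genericTuples (E : Type*) [MetricSpace E] (n : ℕ) : Set (Fin n → E) :=
  {x | Function.Injective x ∧ TieFree (Set.range x)}

theorem ae_pi_of_forall_insertNth {E : Type*} [MeasurableSpace E] {μ : Measure E}
    [IsProbabilityMeasure μ] {n : ℕ} (j : Fin (n + 1)) {p : (Fin (n + 1) → E) → Prop}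
    (hp : MeasurableSet {x | p x})
    (h : ∀ y : Fin n → E, ∀ᵐ a ∂μ, p (j.insertNth a y)) :
    ∀ᵐ x ∂Measure.pi fun _ : Fin (n + 1) => μ, p x := by
  rw [← (measurePreserving_insertNth μ j).map_eq,
    ae_map_iff (measurePreserving_insertNth μ j).measurable.aemeasurable hp]
  have hm : MeasurableSet {q : E × (Fin n → E) | p (j.insertNth q.1 q.2)} :=
    (measurePreserving_insertNth μ j).measurable hp
  have h2 : ∀ᵐ q ∂(Measure.pi fun _ : Fin n => μ).prod μ, p (j.insertNth q.2 q.1) :=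
    (Measure.ae_prod_iff_ae_ae (hm.preimage measurable_swap)).2 (ae_of_all _ h)
  exact Measure.measurePreserving_swap.quasiMeasurePreserving.ae h2

/-- With the other points fixed, a coincidence puts one point on a singleton, and a tie puts it on a
sphere. Both are null sets in positive dimension. -/
theorem ae_mem_genericTuples (hd : 1 ≤ d) {μ : Measure 𝔼} [IsProbabilityMeasure μ]
    (hμ : μ ≪ volume) (n : ℕ) :
    ∀ᵐ x ∂Measure.pi fun _ : Fin n => μ, x ∈ genericTuples 𝔼 n := by
  have : Nonempty (Fin d) := ⟨⟨0, hd⟩⟩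
  cases n with
  | zero =>
    refine ae_of_all _ fun x => ⟨fun i => i.elim0, ?_⟩
    rintro _ ⟨i, -⟩
    exact i.elim0
  | succ n =>
    have hm : ∀ i, Measurable fun x : Fin (n + 1) → 𝔼 => x i := fun i => measurable_pi_apply i
    have h1 : ∀ j i : Fin (n + 1), i ≠ j →
        ∀ᵐ x ∂Measure.pi fun _ : Fin (n + 1) => μ, x i ≠ x j := by
      intro j i hij
      obtain ⟨i', rfl⟩ := Fin.exists_succAbove_eq hij
      refine ae_pi_of_forall_insertNth j
        (measurableSet_eq_fun (hm (j.succAbove i')) (hm j)).compl fun y => ?_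
      refine hμ.ae_le ?_
      filter_upwards [compl_mem_ae_iff.2 (measure_singleton (μ := (volume : Measure 𝔼)) (y i'))]
        with a ha
      simpa [eq_comm] using ha
    have h2 : ∀ j i l : Fin (n + 1), i ≠ j → l ≠ j →
        ∀ᵐ x ∂Measure.pi fun _ : Fin (n + 1) => μ, dist (x j) (x i) ≠ dist (x l) (x i) := by
      intro j i l hij hlj
      obtain ⟨i', rfl⟩ := Fin.exists_succAbove_eq hij
      obtain ⟨l', rfl⟩ := Fin.exists_succAbove_eq hlj
      refine ae_pi_of_forall_insertNth j (measurableSet_eq_fun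
        ((hm j).dist (hm (j.succAbove i')))
        ((hm (j.succAbove l')).dist (hm (j.succAbove i')))).compl fun y => ?_
      refine hμ.ae_le ?_
      filter_upwards [compl_mem_ae_iff.2 (Measure.addHaar_sphere (volume : Measure 𝔼) (y i')
        (dist (y l') (y i')))] with a ha
      exact fun h => ha (Metric.mem_sphere.2 (by simpa only [Fin.insertNth_apply_same, Fin.insertNth_apply_succAbove] using h))
    have h1' : ∀ᵐ x ∂Measure.pi fun _ : Fin (n + 1) => μ, ∀ j i : Fin (n + 1), i ≠ j →
        x i ≠ x j := by
      simpa only [ae_all_iff] using h1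
    have h2' : ∀ᵐ x ∂Measure.pi fun _ : Fin (n + 1) => μ, ∀ j i l : Fin (n + 1), i ≠ j → l ≠ j →
        dist (x j) (x i) ≠ dist (x l) (x i) := by
      simpa only [ae_all_iff] using h2
    filter_upwards [h1', h2'] with x hx1 hx2
    refine ⟨fun i j hij => by_contra fun hne => hx1 j i hne hij, ?_⟩
    rintro _ ⟨i, rfl⟩ _ ⟨j, rfl⟩ _ ⟨l, rfl⟩ hji hli hdist
    by_contra hjl
    refine hx2 j i l (fun h => hji (by rw [h])) (fun h => hjl (by rw [h])) hdist

theorem mem_genericTuples_degree {n k : ℕ} {T : Finset 𝔼} {K : ℕ}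
    (hT : ∀ u : 𝔼, u ≠ 0 → ∃ c ∈ T, u ∈ cone c) (hK : k + k * T.card ≤ K) {x : Fin n → 𝔼}
    (hx : x ∈ genericTuples 𝔼 n) {v : 𝔼} (hv : v ∈ Set.range x) :
    (k < n → (k : ℕ∞) ≤ degree k (Set.range x) v) ∧ degree k (Set.range x) v ≤ (K : ℕ∞) := by
  refine ⟨fun hkn => le_degree (Set.finite_range x) hv ?_, (hx.2.degree_le hT hv).trans ?_⟩
  · rw [← Set.image_univ, hx.1.injOn.encard_image, Set.encard_univ, ENat.card_eq_coe_fintype_card,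
      Fintype.card_fin]
    exact_mod_cast hkn
  · exact_mod_cast hK

/-- Deleting the `i`-th point leaves the same set in both configurations, and each deletion changes
the count by at most `1 + K + K * K`. -/
theorem abs_vertexCount_sub_le {n k ℓ : ℕ} {T : Finset 𝔼} {K : ℕ}
    (hT : ∀ u : 𝔼, u ≠ 0 → ∃ c ∈ T, u ∈ cone c) (hK : k + k * T.card ≤ K) (i : Fin n)
    {x y : Fin n → 𝔼} (hx : x ∈ genericTuples 𝔼 n) (hy : y ∈ genericTuples 𝔼 n)
    (hxy : ∀ j ≠ i, x j = y j) :
    |(vertexCount k ℓ (Set.range x) : ℝ) - vertexCount k ℓ (Set.range y)| ≤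
      2 * (1 + K + K * K : ℕ) := by
  have key : ∀ z : Fin n → 𝔼, z ∈ genericTuples 𝔼 n →
      |(vertexCount k ℓ (Set.range z) : ℝ) - vertexCount k ℓ (z '' {j | j ≠ i})| ≤
        (1 + K + K * K : ℕ) := by
    intro z hz
    have hins : insert (z i) (z '' {j | j ≠ i}) = Set.range z := by
      rw [← Set.image_insert_eq, ← Set.image_univ]
      congr 1
      ext j
      simp [em]
    have hni : z i ∉ z '' {j | j ≠ i} := by
      rintro ⟨j, hj, hji⟩
      exact hj (hz.1 hji)
    have hsub : z '' {j | j ≠ i} ⊆ Set.range z := Set.image_subset_range _ _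
    have h := vertexCount_insert_le (k := k) (ℓ := ℓ) (K := K)
      ((Set.finite_range z).subset hsub) hni
      (by
        rw [hins]
        exact fun v hv => (mem_genericTuples_degree hT hK hz hv).2)
      (fun v hv => ((hz.2.mono hsub).degree_le hT hv).trans (by exact_mod_cast hK))
    rw [hins] at h
    have h1 : (vertexCount k ℓ (Set.range z) : ℝ) ≤ vertexCount k ℓ (z '' {j | j ≠ i}) +
        (1 + K + K * K : ℕ) := by exact_mod_cast h.1
    have h2 : (vertexCount k ℓ (z '' {j | j ≠ i}) : ℝ) ≤ vertexCount k ℓ (Set.range z) +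
        (1 + K + K * K : ℕ) := by exact_mod_cast h.2
    rw [abs_le]
    constructor <;> linarith
  have heq : x '' {j | j ≠ i} = y '' {j | j ≠ i} := Set.image_congr fun j hj => hxy j hj
  have h1 := key x hx
  have h2 := key y hy
  rw [heq] at h1
  rw [abs_le] at h1 h2 ⊢
  constructor <;> linarith [h1.1, h1.2, h2.1, h2.2]

/-! ### The mean number of vertices of given degree -/

theorem vertexCount_range_le {E : Type*} [Dist E] (k ℓ : ℕ) {n : ℕ} (x : Fin n → E) :
    vertexCount k ℓ (Set.range x) ≤ n := by
  refine (Set.ncard_le_ncard (t := Set.range x) (fun v hv => hv.1) (Set.finite_range x)).trans ?_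
  rw [← Set.image_univ]
  refine (Set.ncard_image_le Set.finite_univ).trans ?_
  simp [Set.ncard_univ]

theorem vertexCount_range_eq_sum {E : Type*} [MetricSpace E] (k ℓ : ℕ) {n : ℕ} {x : Fin n → E}
    (hx : Function.Injective x) :
    (vertexCount k ℓ (Set.range x) : ℝ) =
      ∑ i, Set.indicator {x : Fin n → E | degree k (Set.range x) (x i) ∈ ({(ℓ : ℕ∞)} : Set ℕ∞)}
        1 x := by
  classical
  have : {v | v ∈ Set.range x ∧ degree k (Set.range x) v = (ℓ : ℕ∞)} =
      x '' {i | degree k (Set.range x) (x i) = (ℓ : ℕ∞)} := by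
    ext v
    constructor
    · rintro ⟨⟨i, rfl⟩, hi⟩
      exact ⟨i, hi, rfl⟩
    · rintro ⟨i, hi, rfl⟩
      exact ⟨⟨i, rfl⟩, hi⟩
  rw [vertexCount, this, Set.ncard_image_of_injective _ hx, Set.ncard_eq_toFinset_card',
    Set.toFinset_ofPred, Finset.card_filter]
  push_cast
  refine Finset.sum_congr rfl fun i _ => ?_
  simp [Set.indicator_apply]

theorem measurable_vertexCount_range (k ℓ n : ℕ) :
    Measurable fun x : Fin n → 𝔼 => (vertexCount k ℓ (Set.range x) : ℝ) :=
  measurable_from_top.comp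
    ((enumerated_range n).measurable_vertexCount (fun x => Set.finite_range x) k ℓ)

theorem integrable_vertexCount_range (k ℓ n : ℕ) (P : Measure (Fin n → 𝔼)) [IsFiniteMeasure P] :
    Integrable (fun x : Fin n → 𝔼 => (vertexCount k ℓ (Set.range x) : ℝ)) P :=
  integrable_of_abs_le (B := n) (measurable_vertexCount_range k ℓ n) fun x => by
    rw [Nat.abs_cast]
    exact_mod_cast vertexCount_range_le k ℓ x

/-- Linearity of expectation: bringing any index to the front preserves the product measure, so each
of the `n + 1` points contributes the same probability. -/
theorem integral_vertexCount_range (hd : 1 ≤ d) (k ℓ : ℕ) {f : 𝔼 → ℝ} (hf : IsProbDensity f)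
    (n : ℕ) :
    ∫ x, (vertexCount k ℓ (Set.range x) : ℝ)
      ∂(Measure.pi fun _ : Fin (n + 1) => densityMeasure f) = (n + 1) * degreeProb k ℓ f n := by
  have := hf.isProbabilityMeasure
  have hm : ∀ i : Fin (n + 1), MeasurableSet
      {x : Fin (n + 1) → 𝔼 | degree k (Set.range x) (x i) ∈ ({(ℓ : ℕ∞)} : Set ℕ∞)} := fun i =>
    (enumerated_range (n + 1)).measurable_degree k (measurable_pi_apply i)
      (Set.to_countable _).measurableSet
  calc _ = ∫ x, ∑ i, Set.indicator {x : Fin (n + 1) → 𝔼 |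
          degree k (Set.range x) (x i) ∈ ({(ℓ : ℕ∞)} : Set ℕ∞)} (1 : (Fin (n + 1) → 𝔼) → ℝ) x
          ∂(Measure.pi fun _ : Fin (n + 1) => densityMeasure f) := by
        refine integral_congr_ae ?_
        filter_upwards [ae_mem_genericTuples hd (μ := densityMeasure f)
          (withDensity_absolutelyContinuous _ _) (n + 1)] with x hx
        exact vertexCount_range_eq_sum k ℓ hx.1
    _ = ∑ i : Fin (n + 1), degreeProb k ℓ f n := by
        rw [integral_finsetSum _ fun i _ => (integrable_const 1).indicator (hm i)]
        refine Finset.sum_congr rfl fun i _ => ?_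
        rw [integral_indicator_one (hm i), degreeProb, Measure.real, Measure.real,
          ← (measurePreserving_insertNth (densityMeasure f) i).measure_preimage
            (hm i).nullMeasurableSet]
        congr 2
        ext p
        simp
        rfl
    _ = _ := by simp

theorem sum_degreeProb (hd : 1 ≤ d) {k : ℕ} {T : Finset 𝔼} {K : ℕ}
    (hT : ∀ u : 𝔼, u ≠ 0 → ∃ c ∈ T, u ∈ cone c) (hK : k + k * T.card ≤ K) {f : 𝔼 → ℝ}
    (hf : IsProbDensity f) {n : ℕ} (hn : k ≤ n) :
    ∑ ℓ ∈ Finset.Icc k K, degreeProb k ℓ f n = 1 := by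
  have := hf.isProbabilityMeasure
  have hgen := (measurePreserving_insertNth (densityMeasure f)
    (0 : Fin (n + 1))).quasiMeasurePreserving.ae (ae_mem_genericTuples hd (μ := densityMeasure f)
      (withDensity_absolutelyContinuous _ _) (n + 1))
  unfold degreeProb
  rw [← measureReal_biUnion_finset]
  · rw [Measure.real, (mem_ae_iff_prob_eq_one (Finset.measurableSet_biUnion _
      fun ℓ _ => measurableSet_degree_insert_range k n _)).1, ENNReal.toReal_one]
    filter_upwards [hgen] with p hp
    have hrange : Set.range ((0 : Fin (n + 1)).insertNth p.1 p.2 : Fin (n + 1) → 𝔼) =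
        insert p.1 (Set.range p.2) := by
      rw [Fin.insertNth_zero', Fin.range_cons]
    have h := mem_genericTuples_degree hT hK hp (v := p.1) (by simp)
    rw [hrange] at h
    obtain ⟨m, hm⟩ := ENat.ne_top_iff_exists.1 (ne_top_of_le_ne_top (ENat.natCast_ne_top K) h.2)
    rw [← hm] at h
    refine Set.mem_biUnion (x := m) ?_ hm.symm
    rw [Finset.mem_coe, Finset.mem_Icc]
    exact ⟨by exact_mod_cast h.1 (Nat.lt_succ_of_le hn), by exact_mod_cast h.2⟩
  · intro ℓ _ ℓ' _ hne
    refine Set.disjoint_left.2 fun p h1 h2 => hne ?_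
    have : (ℓ : ℕ∞) = ℓ' := by
      rw [← Set.mem_singleton_iff.1 h1]
      exact h2
    exact_mod_cast this
  · exact fun ℓ _ => measurableSet_degree_insert_range k n _

/-! ### The limiting degree distribution -/

theorem isProbDensity_indicator_unitCube :
    IsProbDensity ((unitCube (0 : Fin d → ℤ)).indicator 1) := by
  have hm : MeasurableSet (unitCube (0 : Fin d → ℤ)) := measurableSet_unitCube 0
  have hv : volume (unitCube (0 : Fin d → ℤ)) = 1 := by
    have := measure_univ (μ := cubeMeasure (0 : Fin d → ℤ))
    rwa [cubeMeasure, Measure.restrict_apply_univ] at this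
  refine ⟨fun x => Set.indicator_nonneg (fun _ _ => zero_le_one) x, ?_, ?_⟩
  · rw [integrable_indicator_iff hm]
    exact integrableOn_const (by simp [hv])
  · rw [integral_indicator_one hm, Measure.real, hv, ENNReal.toReal_one]

/-- No mass escapes: for one concrete density, uniform on a unit cube, the finite sample degrees lie
in `[k, K]` almost surely, and a finite sum passes to the limit. -/
theorem sum_limitProb (hd : 1 ≤ d) {k : ℕ} {T : Finset 𝔼} {K : ℕ}
    (hT : ∀ u : 𝔼, u ≠ 0 → ∃ c ∈ T, u ∈ cone c) (hK : k + k * T.card ≤ K) :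
    ∑ ℓ ∈ Finset.Icc k K, limitProb d k ℓ = 1 := by
  have hf := isProbDensity_indicator_unitCube (d := d)
  have h := tendsto_finsetSum (Finset.Icc k K) fun ℓ _ => tendsto_degreeProb hd k ℓ hf
  refine tendsto_nhds_unique h (tendsto_const_nhds.congr' ?_)
  filter_upwards [eventually_ge_atTop k] with n hn using (sum_degreeProb hd hT hK hf hn).symm

/-! ### Binomial processes -/

theorem ae_of_hasLaw {Ω E : Type*} [MeasurableSpace Ω] [MeasurableSpace E] {X : Ω → E}
    {μ : Measure E} {P : Measure Ω} (hX : HasLaw X μ P) {p : E → Prop} (h : ∀ᵐ x ∂μ, p x) :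
    ∀ᵐ ω ∂P, p (X ω) :=
  ae_of_ae_map hX.aemeasurable (hX.map_eq.symm ▸ h)

theorem tendsto_integral_vertexCount_range (hd : 1 ≤ d) (k ℓ : ℕ) {f : 𝔼 → ℝ}
    (hf : IsProbDensity f) :
    Tendsto (fun n : ℕ => 1 / (n : ℝ) * ∫ x, (vertexCount k ℓ (Set.range x) : ℝ)
      ∂(Measure.pi fun _ : Fin n => densityMeasure f)) atTop (𝓝 (limitProb d k ℓ)) := by
  rw [← tendsto_add_atTop_iff_nat 1]
  refine (tendsto_degreeProb hd k ℓ hf).congr fun n => ?_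
  rw [integral_vertexCount_range hd k ℓ hf]
  push_cast
  field_simp

/-- McDiarmid's inequality bounds each deviation probability exponentially in `n`. The first
Borel–Cantelli lemma, applied for each tolerance `1 / (j + 1)`, uses only the marginal laws of the
`X n`. -/
theorem ae_tendsto_vertexCount_range (hd : 1 ≤ d) {k : ℕ} {T : Finset 𝔼}
    (hT : ∀ u : 𝔼, u ≠ 0 → ∃ c ∈ T, u ∈ cone c) (ℓ : ℕ) {f : 𝔼 → ℝ} (hf : IsProbDensity f)
    {Ω : Type*} [MeasurableSpace Ω] {P : Measure Ω} {X : (n : ℕ) → Ω → (Fin n → 𝔼)}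
    (hX : ∀ n, HasLaw (X n) (Measure.pi fun _ : Fin n => densityMeasure f) P) :
    ∀ᵐ ω ∂P, Tendsto (fun n : ℕ => 1 / (n : ℝ) * (vertexCount k ℓ (Set.range (X n ω)) : ℝ)) atTop
      (𝓝 (limitProb d k ℓ)) := by
  have := hf.isProbabilityMeasure
  set c : ℝ := 2 * (1 + (k + k * T.card) + (k + k * T.card) * (k + k * T.card) : ℕ) with hc
  have hc0 : 0 < c := by positivity
  set m : ℕ → ℝ := fun n => ∫ x, (vertexCount k ℓ (Set.range x) : ℝ)
      ∂(Measure.pi fun _ : Fin n => densityMeasure f) with hm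
  have hev : ∀ j : ℕ, ∀ᵐ ω ∂P, ∀ᶠ n : ℕ in atTop,
      ω ∉ {ω | 1 / ((j : ℝ) + 1) * n ≤ |(vertexCount k ℓ (Set.range (X n ω)) : ℝ) - m n|} := by
    intro j
    refine ae_eventually_notMem ?_
    have hs : Summable fun n : ℕ =>
        2 * Real.exp (-((1 / ((j : ℝ) + 1)) ^ 2 / (2 * c ^ 2)) * n) := by
      refine Summable.mul_left 2 ?_
      simp_rw [mul_comm _ (Nat.cast (R := ℝ) _)]
      exact Real.summable_exp_nat_mul_iff.2 (neg_lt_zero.2 (by positivity))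
    refine ne_top_of_le_ne_top hs.tsum_ofReal_ne_top (ENNReal.tsum_le_tsum fun n => ?_)
    have hmeas : MeasurableSet {x : Fin n → 𝔼 |
        1 / ((j : ℝ) + 1) * n ≤ |(vertexCount k ℓ (Set.range x) : ℝ) - m n|} :=
      measurableSet_le measurable_const
        ((measurable_vertexCount_range k ℓ n).sub_const _).norm
    rw [(hX n).measure_eq hmeas]
    refine (ENNReal.le_ofReal_iff_toReal_le (measure_ne_top _ _) (by positivity)).2 ?_
    refine measure_abs_sub_integral_ge_le (densityMeasure f) hc0
      (measurable_vertexCount_range k ℓ n) (B := n) (fun x => ?_)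
      (ae_mem_genericTuples hd (μ := densityMeasure f) (withDensity_absolutelyContinuous _ _) n)
      (fun i x hx y hy hxy => abs_vertexCount_sub_le hT le_rfl i hx hy hxy) (by positivity)
    rw [Nat.abs_cast]
    exact_mod_cast vertexCount_range_le k ℓ x
  filter_upwards [ae_all_iff.2 hev] with ω hω
  have h0 : Tendsto (fun n : ℕ => 1 / (n : ℝ) * ((vertexCount k ℓ (Set.range (X n ω)) : ℝ) - m n))
      atTop (𝓝 0) := by
    rw [Metric.tendsto_nhds]
    intro ε hε
    obtain ⟨j, hj⟩ := exists_nat_one_div_lt hε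
    filter_upwards [hω j, eventually_gt_atTop 0] with n hn hn0
    have hn0' : (0 : ℝ) < n := by exact_mod_cast hn0
    replace hn := not_le.1 hn
    rw [dist_zero_right, Real.norm_eq_abs, abs_mul, abs_of_pos (one_div_pos.2 hn0'),
      one_div_mul_eq_div, div_lt_iff₀ hn0']
    exact hn.trans_le (mul_le_mul_of_nonneg_right hj.le hn0'.le)
  have h := h0.add (tendsto_integral_vertexCount_range hd k ℓ hf)
  rw [zero_add] at h
  refine h.congr fun n => ?_
  simp only [hm]
  ring

/-! ### Poisson processes -/

theorem pointSet_eq_range {E : Type*} (ω : ℕ × (ℕ → E)) :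
    pointSet ω = Set.range fun i : Fin ω.1 => ω.2 i := by
  ext y
  simp only [pointSet, Set.mem_image, Set.mem_range, Set.mem_ofPred_eq]
  exact ⟨fun ⟨i, hi, h⟩ => ⟨⟨i, hi⟩, h⟩, fun ⟨i, h⟩ => ⟨i, i.2, h⟩⟩

theorem ae_poissonLaw_mem_genericTuples (hd : 1 ≤ d) {μ : Measure 𝔼} [IsProbabilityMeasure μ]
    (hμ : μ ≪ volume) (ν : ℝ≥0) :
    ∀ᵐ ω ∂poissonLaw ν μ, (fun i : Fin ω.1 => ω.2 i) ∈ genericTuples 𝔼 ω.1 := by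
  have h : ∀ᵐ X ∂Measure.infinitePi fun _ : ℕ => μ, ∀ m : ℕ,
      (fun i : Fin m => X i) ∈ genericTuples 𝔼 m :=
    ae_all_iff.2 fun m => (measurePreserving_infinitePi_fin μ m).quasiMeasurePreserving.ae
      (ae_mem_genericTuples hd hμ m)
  filter_upwards [Measure.quasiMeasurePreserving_snd.ae h] with ω hω using hω ω.1

theorem measurable_vertexCount_pointSet (k ℓ : ℕ) :
    Measurable fun ω : ℕ × (ℕ → 𝔼) => (vertexCount k ℓ (pointSet ω) : ℝ) :=
  measurable_from_top.comp (enumerated_pointSet.measurable_vertexCount pointSet_finite k ℓ)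

theorem lintegral_vertexCount_pointSet (hd : 1 ≤ d) (k ℓ : ℕ) {f : 𝔼 → ℝ} (hf : IsProbDensity f)
    (ν : ℝ≥0) :
    ∫⁻ ω, ENNReal.ofReal (vertexCount k ℓ (pointSet ω)) ∂poissonLaw ν (densityMeasure f) =
      ν * ∫⁻ n, ENNReal.ofReal (degreeProb k ℓ f n) ∂poissonMeasure ν := by
  have := hf.isProbabilityMeasure
  rw [lintegral_poissonLaw ν (densityMeasure f) (g := fun S => ENNReal.ofReal (vertexCount k ℓ S))
    (measurable_vertexCount_pointSet k ℓ).ennreal_ofReal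
    fun m => (measurable_vertexCount_range k ℓ m).ennreal_ofReal]
  have hint : ∀ m : ℕ, ∫⁻ x, ENNReal.ofReal (vertexCount k ℓ (Set.range x))
      ∂(Measure.pi fun _ : Fin m => densityMeasure f) =
      ENNReal.ofReal (∫ x, (vertexCount k ℓ (Set.range x) : ℝ)
        ∂(Measure.pi fun _ : Fin m => densityMeasure f)) := fun m =>
    (ofReal_integral_eq_lintegral_ofReal (integrable_vertexCount_range k ℓ m _)
      (ae_of_all _ fun _ => Nat.cast_nonneg _)).symm
  have h0 : ∀ x : Fin 0 → 𝔼, vertexCount k ℓ (Set.range x) = 0 := fun x =>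
    Nat.le_zero.1 (vertexCount_range_le k ℓ x)
  simp_rw [hint]
  rw [tsum_eq_zero_add' ENNReal.summable, lintegral_countable', ← ENNReal.tsum_mul_left]
  simp only [h0, Nat.cast_zero, integral_zero, ENNReal.ofReal_zero, mul_zero, zero_add]
  -- Termwise this is `(m + 1) P(N = m + 1) = ν P(N = m)`: one of the `m + 1` points is singled out
  -- and the other `m` are again Poisson in number.
  refine tsum_congr fun m => ?_
  rw [integral_vertexCount_range hd k ℓ hf, poissonMeasure_singleton, poissonMeasure_singleton,
    ← ENNReal.ofReal_coe_nnreal, ← ENNReal.ofReal_mul (by positivity), ← ENNReal.ofReal_mul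
      (show 0 ≤ degreeProb k ℓ f m from measureReal_nonneg), ← ENNReal.ofReal_mul ν.coe_nonneg]
  congr 1
  rw [Nat.factorial_succ]
  push_cast
  field_simp
  ring

theorem integrable_vertexCount_pointSet (hd : 1 ≤ d) (k ℓ : ℕ) {f : 𝔼 → ℝ} (hf : IsProbDensity f)
    (ν : ℝ≥0) :
    Integrable (fun ω => (vertexCount k ℓ (pointSet ω) : ℝ))
      (poissonLaw ν (densityMeasure f)) := by
  have := hf.isProbabilityMeasure
  refine ⟨(measurable_vertexCount_pointSet k ℓ).aestronglyMeasurable, ?_⟩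
  rw [hasFiniteIntegral_iff_ofReal (ae_of_all _ fun _ => Nat.cast_nonneg _),
    lintegral_vertexCount_pointSet hd k ℓ hf]
  refine ENNReal.mul_lt_top ENNReal.coe_lt_top ?_
  calc _ ≤ ∫⁻ _, 1 ∂poissonMeasure ν :=
        lintegral_mono fun n => ENNReal.ofReal_le_one.2 measureReal_le_one
    _ < ∞ := by simp

theorem integral_vertexCount_pointSet (hd : 1 ≤ d) (k ℓ : ℕ) {f : 𝔼 → ℝ} (hf : IsProbDensity f)
    (ν : ℝ≥0) :
    ∫ ω, (vertexCount k ℓ (pointSet ω) : ℝ) ∂poissonLaw ν (densityMeasure f) =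
      ν * ∫ n, degreeProb k ℓ f n ∂poissonMeasure ν := by
  rw [integral_eq_lintegral_of_nonneg_ae (ae_of_all _ fun _ => Nat.cast_nonneg _)
      (measurable_vertexCount_pointSet k ℓ).aestronglyMeasurable,
    lintegral_vertexCount_pointSet hd k ℓ hf,
    integral_eq_lintegral_of_nonneg_ae (f := degreeProb k ℓ f)
      (ae_of_all _ fun _ => measureReal_nonneg)
      measurable_from_top.aestronglyMeasurable, ENNReal.toReal_mul, ENNReal.coe_toReal]

theorem tendsto_poissonMeasure_Iio (M : ℕ) :
    Tendsto (fun ν : ℝ≥0 => (poissonMeasure ν).real (Set.Iio M)) atTop (𝓝 0) := by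
  have h : ∀ ν : ℝ≥0, (poissonMeasure ν).real (Set.Iio M) =
      ∑ m ∈ Finset.range M, (m ! : ℝ)⁻¹ * ((ν : ℝ) ^ m * Real.exp (-ν)) := fun ν => by
    rw [← Finset.coe_range, ← sum_measureReal_singleton]
    refine Finset.sum_congr rfl fun m _ => ?_
    rw [poissonMeasure_real_singleton]
    ring
  simp_rw [h]
  rw [← Finset.sum_const_zero (s := Finset.range M)]
  refine tendsto_finsetSum _ fun m _ => ?_
  have h1 := ((Real.tendsto_pow_mul_exp_neg_atTop_nhds_zero m).comp
    (NNReal.tendsto_coe_atTop.2 tendsto_id)).const_mul (m ! : ℝ)⁻¹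
  rw [mul_zero] at h1
  exact h1

/-- A Poisson variable exceeds any fixed level with probability tending to one, and a convergent
sequence is bounded on the remaining event. -/
theorem tendsto_integral_poissonMeasure {a : ℕ → ℝ} {L : ℝ} (h : Tendsto a atTop (𝓝 L)) :
    Tendsto (fun ν : ℝ≥0 => ∫ n, a n ∂poissonMeasure ν) atTop (𝓝 L) := by
  obtain ⟨C, hC⟩ := (h.sub_const L).norm.bddAbove_range
  have hC' : ∀ n, ‖a n - L‖ ≤ C := fun n => hC ⟨n, rfl⟩
  have hint : ∀ ν : ℝ≥0, Integrable (fun n => a n - L) (poissonMeasure ν) := fun ν =>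
    .of_bound measurable_from_top.aestronglyMeasurable C (ae_of_all _ hC')
  rw [Metric.tendsto_nhds]
  intro ε hε
  obtain ⟨M, hM⟩ := Metric.tendsto_atTop.1 h (ε / 2) (half_pos hε)
  have h1 := (tendsto_poissonMeasure_Iio M).const_mul C
  rw [mul_zero] at h1
  filter_upwards [h1.eventually_lt_const (half_pos hε)] with ν hν
  have h2 : ∫ n, a n ∂poissonMeasure ν - L = ∫ n, (a n - L) ∂poissonMeasure ν := by
    have : Integrable a (poissonMeasure ν) :=
      ((hint ν).add (integrable_const L)).congr (ae_of_all _ fun n => sub_add_cancel _ _)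
    rw [integral_sub this (integrable_const L)]
    simp
  rw [dist_eq_norm, h2]
  calc _ ≤ ∫ n, ‖a n - L‖ ∂poissonMeasure ν := norm_integral_le_integral_norm _
    _ ≤ ∫ n, (ε / 2 + (Set.Iio M).indicator (fun _ => C) n) ∂poissonMeasure ν := by
        refine integral_mono (hint ν).norm ((integrable_const _).add
          ((integrable_const C).indicator measurableSet_Iio)) fun n => ?_
        by_cases hn : n < M
        · simp only [Set.indicator_of_mem (Set.mem_Iio.2 hn)]
          linarith [hC' n]
        · simp only [Set.indicator_of_notMem (fun h => hn (Set.mem_Iio.1 h)), add_zero]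
          rw [← dist_eq_norm]
          exact (hM n (not_lt.1 hn)).le
    _ = ε / 2 + C * (poissonMeasure ν).real (Set.Iio M) := by
        rw [integral_add (integrable_const _) ((integrable_const C).indicator measurableSet_Iio),
          integral_indicator_const C measurableSet_Iio]
        simp [mul_comm]
    _ < ε := by linarith

end Euclidean

end KNN

end

/-! ### Assembly of the theorem. -/

theorem theorem7p1 (d k : ℕ) (hd : 1 ≤ d) (hk : 1 ≤ k) :
    ∃ K : ℕ, k < K ∧
      (∑ ℓ ∈ Finset.Icc k K, KNN.limitProb d k ℓ = 1) ∧
      ∀ f : EuclideanSpace ℝ (Fin d) → ℝ, KNN.IsProbDensity f →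
        -- Poisson processes, `Y ν` having intensity function `ν f`
        (∀ (Ω : Type*) [MeasurableSpace Ω] (P : Measure Ω) [IsProbabilityMeasure P]
            (Y : ℝ≥0 → Ω → ℕ × (ℕ → EuclideanSpace ℝ (Fin d))),
            (∀ ν : ℝ≥0, 0 < ν → HasLaw (Y ν) (KNN.poissonLaw ν (KNN.densityMeasure f)) P) →
            (∀ ν : ℝ≥0, 0 < ν → ∀ᵐ ω ∂P, ∀ x ∈ KNN.pointSet (Y ν ω),
              ((k : ℕ∞) < (KNN.pointSet (Y ν ω)).encard →
                (k : ℕ∞) ≤ KNN.degree k (KNN.pointSet (Y ν ω)) x) ∧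
              KNN.degree k (KNN.pointSet (Y ν ω)) x ≤ (K : ℕ∞)) ∧
            ∀ ℓ ∈ Finset.Icc k K,
              (∀ ν : ℝ≥0, 0 < ν →
                Integrable (fun ω => (KNN.vertexCount k ℓ (KNN.pointSet (Y ν ω)) : ℝ)) P) ∧
              Tendsto
                (fun ν : ℝ≥0 =>
                  1 / (ν : ℝ) * ∫ ω, (KNN.vertexCount k ℓ (KNN.pointSet (Y ν ω)) : ℝ) ∂P)
                atTop (𝓝 (KNN.limitProb d k ℓ))) ∧
        -- binomial processes, `X n` consisting of `n` independent points with density `f`;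
        -- nothing is assumed about the joint law of `X n` for different `n`
        (∀ (Ω : Type*) [MeasurableSpace Ω] (P : Measure Ω) [IsProbabilityMeasure P]
            (X : (n : ℕ) → Ω → (Fin n → EuclideanSpace ℝ (Fin d))),
            (∀ n : ℕ, HasLaw (X n) (Measure.pi fun _ : Fin n => KNN.densityMeasure f) P) →
            (∀ n : ℕ, ∀ᵐ ω ∂P, ∀ x ∈ Set.range (X n ω),
              (k < n → (k : ℕ∞) ≤ KNN.degree k (Set.range (X n ω)) x) ∧
              KNN.degree k (Set.range (X n ω)) x ≤ (K : ℕ∞)) ∧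
            (∀ ℓ ∈ Finset.Icc k K,
              (∀ n : ℕ,
                Integrable (fun ω => (KNN.vertexCount k ℓ (Set.range (X n ω)) : ℝ)) P) ∧
              Tendsto
                (fun n : ℕ =>
                  1 / (n : ℝ) * ∫ ω, (KNN.vertexCount k ℓ (Set.range (X n ω)) : ℝ) ∂P)
                atTop (𝓝 (KNN.limitProb d k ℓ))) ∧
            ∀ᵐ ω ∂P, ∀ ℓ ∈ Finset.Icc k K,
              Tendsto
                (fun n : ℕ => 1 / (n : ℝ) * (KNN.vertexCount k ℓ (Set.range (X n ω)) : ℝ))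
                atTop (𝓝 (KNN.limitProb d k ℓ))) := by
  open KNN in
  obtain ⟨T, -, hT⟩ := exists_cone_cover (E := EuclideanSpace ℝ (Fin d))
  -- The degree bound is `k + k * T.card`; the extra `1` makes `k < K` hold without showing that `T`
  -- is nonempty.
  have hK : k + k * T.card ≤ k + k * T.card + 1 := Nat.le_succ _
  refine ⟨k + k * T.card + 1, by omega, sum_limitProb hd hT hK, fun f hf => ?_⟩
  have := hf.isProbabilityMeasure
  have hac : densityMeasure f ≪ volume := withDensity_absolutelyContinuous _ _
  refine ⟨fun Ω _ P _ Y hY => ⟨fun ν hν => ?_, fun ℓ _ => ⟨fun ν hν => ?_, ?_⟩⟩,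
    fun Ω _ P _ X hX => ⟨fun n => ?_, fun ℓ _ => ⟨fun n => ?_, ?_⟩, ?_⟩⟩
  · filter_upwards [ae_of_hasLaw (hY ν hν) (ae_poissonLaw_mem_genericTuples hd hac ν)] with ω hω
    rw [pointSet_eq_range]
    intro x hx
    have h := mem_genericTuples_degree hT hK hω hx
    refine ⟨fun hcard => h.1 ?_, h.2⟩
    rw [← Set.image_univ] at hcard
    have h1 := hcard.trans_le (Set.encard_image_le _ _)
    rw [Set.encard_univ, ENat.card_eq_coe_fintype_card, Fintype.card_fin] at h1
    exact_mod_cast h1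
  · have h := integrable_vertexCount_pointSet hd k ℓ hf ν
    rw [← (hY ν hν).map_eq] at h
    exact h.comp_aemeasurable (hY ν hν).aemeasurable
  · refine (tendsto_integral_poissonMeasure (tendsto_degreeProb hd k ℓ hf)).congr' ?_
    filter_upwards [eventually_gt_atTop 0] with ν hν
    have h := (hY ν hν).integral_comp
      (f := fun ω => (vertexCount k ℓ (pointSet ω) : ℝ))
      (measurable_vertexCount_pointSet k ℓ).aestronglyMeasurable
    rw [integral_vertexCount_pointSet hd k ℓ hf] at h
    have hν' : (ν : ℝ) ≠ 0 := by exact_mod_cast hν.ne'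
    rw [show ∫ ω, (vertexCount k ℓ (pointSet (Y ν ω)) : ℝ) ∂P = _ from h]
    field_simp
  · filter_upwards [ae_of_hasLaw (hX n) (ae_mem_genericTuples hd hac n)] with ω hω x hx
      using mem_genericTuples_degree hT hK hω hx
  · have h := integrable_vertexCount_range k ℓ n (Measure.pi fun _ : Fin n => densityMeasure f)
    rw [← (hX n).map_eq] at h
    exact h.comp_aemeasurable (hX n).aemeasurable
  · refine (tendsto_integral_vertexCount_range hd k ℓ hf).congr fun n => ?_
    rw [← (hX n).integral_comp (measurable_vertexCount_range k ℓ n).aestronglyMeasurable]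
    rfl
  · have h := ae_all_iff.2 fun ℓ => ae_tendsto_vertexCount_range (k := k) hd hT ℓ hf hX
    filter_upwards [h] with ω hω ℓ _ using hω ℓ
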